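/- Let $\vartheta$ be the Riemann–Siegel theta function, i.e. the holomorphic function on $\mathbb{C}$ cut along the two half-lines from $i/2$ to $i\infty$ and from $-i/2$ to $-i\infty$ with $\vartheta(0)=0$ and $e^{2i\vartheta(z)}=\pi^{-iz}\,\Gamma(\tfrac14+\tfrac{iz}{2})/\Gamma(\tfrac14-\tfrac{iz}{2})$. For $t\in\mathbb{R}$ let $$U(t)=\frac{1}{2\pi i}\int_{-ic-\infty}^{-ic+\infty} e^{i\vartheta(t+x)-i\vartheta(t)}\,\zeta\bigl(\tfrac12+i(t+x)\bigr)\,\frac{\pi}{2\sinh\frac{\pi x}{2}}\,dx,$$ where $0<c<\tfrac12$ (the value does not depend on $c$). Theorem. Let $0<\varepsilon<1$ and $0<\sigma<2$. There is a constant $C_0>0$ such that for every $C\ge C_0$, with $b=C\log t$, as $t\to+\infty$, $$U(t)=\frac{1}{2\pi i}\int_{-b-i\sigma}^{b-i\sigma}\Bigl(\frac{t}{2\pi}\Bigr)^{\frac{ix}{2}}\zeta\bigl(\tfrac12+i(t+x)\bigr)\,\frac{\pi}{2\sinh\frac{\pi x}{2}}\,dx+O\bigl(t^{-\frac56+\varepsilon}\bigr).$$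 If the Lindelöf hypothesis holds (that is, $\zeta(\tfrac12+it)=O(t^{\delta})$ as $t\to+\infty$ for every $\delta>0$), then for the same $C$ the error term may be replaced by $O(t^{-1+\varepsilon})$. -/

import Mathlib

open Complex Filter Asymptotics

namespace ZetaApprox

noncomputable section

/-- The derivative of the Riemann-Siegel theta function at a complex argument,
`ϑ'(z) = -(log π)/2 + (ψ(1/4 + iz/2) + ψ(1/4 - iz/2))/4`, where `ψ = Γ'/Γ`. -/
def thetaDeriv (z : ℂ) : ℂ :=
  -((Real.log Real.pi : ℝ) : ℂ) / 2
    + (digamma (1 / 4 + I * z / 2) + digamma (1 / 4 - I * z / 2)) / 4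

/-- The Riemann-Siegel theta function: the primitive of `thetaDeriv` vanishing at `0`, obtained by
integrating along the segment from `0` to `z`. On the plane cut along the two imaginary
half-lines from `i/2` to `i∞` and from `-i/2` to `-i∞` (which is star-shaped about `0`, and where
`thetaDeriv` is holomorphic) it is the holomorphic function with `ϑ(0) = 0` and
`exp(2iϑ(z)) = π^(-iz) Γ(1/4 + iz/2) / Γ(1/4 - iz/2)`. -/
def theta (z : ℂ) : ℂ :=
  ∫ s in (0 : ℝ)..1, z * thetaDeriv ((s : ℂ) * z)

/-- The kernel `π / (2 sinh (πx/2))`. -/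
def kernel (x : ℂ) : ℂ :=
  (Real.pi : ℂ) / (2 * sinh ((Real.pi : ℂ) * x / 2))

/-- The function `U(t)`: the integral, divided by `2πi`, of
`e^{iϑ(t+x) - iϑ(t)} ζ(1/2 + i(t+x)) π / (2 sinh (πx/2))`
over the whole horizontal line `x = y - ic`, `y ∈ ℝ`. It is used for `0 < c < 1/2`, where its value
does not depend on `c`. -/
def U (c t : ℝ) : ℂ :=
  1 / (2 * Real.pi * I) *
    ∫ y : ℝ,
      (fun x : ℂ =>
        exp (I * theta (t + x) - I * theta t) * riemannZeta (1 / 2 + I * (t + x)) * kernel x)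
      (y - c * I)

/-- The truncated integral, divided by `2πi`, of
`(t/2π)^{ix/2} ζ(1/2 + i(t+x)) π / (2 sinh (πx/2))`
over the segment `x = y - iσ`, `-b ≤ y ≤ b`. -/
def truncatedIntegral (σ b t : ℝ) : ℂ :=
  1 / (2 * Real.pi * I) *
    ∫ y in (-b)..b,
      (fun x : ℂ =>
        ((t / (2 * Real.pi) : ℝ) : ℂ) ^ (I * x / 2) * riemannZeta (1 / 2 + I * (t + x)) * kernel x)
      (y - σ * I)

/-- The Lindelöf hypothesis: `ζ(1/2 + it) = O(t^δ)` as `t → +∞`, for every `δ > 0`. -/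
def LindelofHypothesis : Prop :=
  ∀ δ : ℝ, 0 < δ →
    (fun t : ℝ => riemannZeta (1 / 2 + I * t)) =O[atTop] (fun t : ℝ => t ^ δ)

end

end ZetaApprox

namespace ZetaApprox

/-- `(s - 1) (n^{-s} - ∫_n^{n+1} u^{-s} du)` at the index `n + 1`, an entire function of `s`. -/
noncomputable def zetaTerm (n : ℕ) (s : ℂ) : ℂ :=
  (s - 1) * ((n + 1 : ℕ) : ℂ) ^ (-s) + ((n + 2 : ℕ) : ℂ) ^ (1 - s) - ((n + 1 : ℕ) : ℂ) ^ (1 - s)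

lemma differentiable_natCast_succ_cpow {n : ℕ} {f : ℂ → ℂ} (hf : Differentiable ℂ f) :
    Differentiable ℂ fun s => ((n + 1 : ℕ) : ℂ) ^ f s := fun s =>
  (hf s).const_cpow (Or.inl (Nat.cast_ne_zero.2 n.succ_ne_zero))

lemma differentiable_zetaTerm (n : ℕ) : Differentiable ℂ (zetaTerm n) := by
  unfold zetaTerm
  have h1 : Differentiable ℂ fun s : ℂ => ((n + 1 : ℕ) : ℂ) ^ (-s) :=
    differentiable_natCast_succ_cpow (by fun_prop)
  have h2 : Differentiable ℂ fun s : ℂ => ((n + 1 : ℕ) : ℂ) ^ (1 - s) :=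
    differentiable_natCast_succ_cpow (by fun_prop)
  have h3 : Differentiable ℂ fun s : ℂ => ((n + 2 : ℕ) : ℂ) ^ (1 - s) :=
    differentiable_natCast_succ_cpow (n := n + 1) (by fun_prop)
  fun_prop

lemma norm_cpow_neg_sub_cpow_neg_le {a u : ℝ} (ha : 0 < a) (hu : a ≤ u) (hu' : u ≤ a + 1) {s : ℂ}
    (hs : 0 < s.re) : ‖(a : ℂ) ^ (-s) - (u : ℂ) ^ (-s)‖ ≤ ‖s‖ * a ^ (-s.re - 1) := by
  have hs0 : s ≠ 0 := fun h => by simp [h] at hs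
  have h := Convex.norm_image_sub_le_of_norm_hasDerivWithin_le
    (f := fun y : ℝ => (y : ℂ) ^ (-s)) (f' := fun y : ℝ => -s * (y : ℂ) ^ (-s - 1))
    (s := Set.Icc a u) (x := u) (y := a) (C := ‖s‖ * a ^ (-s.re - 1))
    (fun x hx => (hasDerivAt_ofReal_cpow_const (by linarith [hx.1] : x ≠ 0 )
      (neg_ne_zero.2 hs0)).hasDerivWithinAt)
    (fun x hx => by
      rw [norm_mul, norm_neg, norm_cpow_eq_rpow_re_of_pos (ha.trans_le hx.1)]
      gcongr
      simp only [sub_re, neg_re, one_re]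
      exact Real.rpow_le_rpow_of_nonpos ha hx.1 (by linarith))
    (convex_Icc a u) ⟨hu, le_rfl⟩ ⟨le_rfl, hu⟩
  refine h.trans ?_
  have : ‖a - u‖ ≤ 1 := by rw [Real.norm_eq_abs, abs_le]; constructor <;> linarith
  have h0 : 0 ≤ ‖s‖ * a ^ (-s.re - 1) := by positivity
  nlinarith

lemma norm_zetaTerm_le (n : ℕ) {s : ℂ} (hs : 0 < s.re) :
    ‖zetaTerm n s‖ ≤ ‖s - 1‖ * ‖s‖ * ((n : ℝ) + 1) ^ (-s.re - 1) := by
  rcases eq_or_ne s 1 with rfl | h1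
  · simp [zetaTerm]
  have ha : (0 : ℝ) < (n : ℝ) + 1 := by positivity
  have h := Convex.norm_image_sub_le_of_norm_hasDerivWithin_le
    (f := fun y : ℝ => (s - 1) * (((y - (n + 1) : ℝ)) * (((n : ℝ) + 1 : ℝ) : ℂ) ^ (-s))
      + (y : ℂ) ^ (1 - s))
    (f' := fun y : ℝ => (s - 1) * ((((n : ℝ) + 1 : ℝ) : ℂ) ^ (-s) - (y : ℂ) ^ (-s)))
    (s := Set.Icc ((n : ℝ) + 1) (n + 2)) (x := n + 1) (y := n + 2)
    (C := ‖s - 1‖ * ‖s‖ * ((n : ℝ) + 1) ^ (-s.re - 1))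
    (fun x hx => by
      have hx0 : x ≠ 0 := by linarith [hx.1]
      have e1 := hasDerivAt_ofReal_cpow_const hx0 (r := 1 - s) (sub_ne_zero.2 h1.symm)
      have e2 : HasDerivAt (fun y : ℝ => ((y - (n + 1) : ℝ) : ℂ)) ((1 : ℝ) : ℂ) x :=
        ((hasDerivAt_id x).sub_const _).ofReal_comp
      have := ((e2.mul_const ((((n : ℝ) + 1 : ℝ) : ℂ) ^ (-s))).const_mul (s - 1)).add e1
      refine HasDerivAt.hasDerivWithinAt (this.congr_deriv ?_)
      rw [show (1 : ℂ) - s - 1 = -s by ring]; push_cast; ring)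
    (fun x hx => by
      rw [norm_mul, mul_assoc]
      gcongr
      exact norm_cpow_neg_sub_cpow_neg_le ha hx.1 (by linarith [hx.2]) hs)
    (convex_Icc _ _) ⟨le_rfl, by linarith⟩ ⟨by linarith, le_rfl⟩
  convert h using 1
  · unfold zetaTerm; push_cast; congr 1; ring_nf
  · norm_num

lemma rpow_le_two_mul_sub (x : ℝ) (hx : 1 ≤ x) {σ : ℝ} (hσ : 1 / 2 ≤ σ) :
    (x + 1) ^ (-σ - 1) ≤ 2 * (x ^ (-(1 / 2) : ℝ) - (x + 1) ^ (-(1 / 2) : ℝ)) := by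
  have h0 : (x + 1) ^ (-σ - 1) ≤ (x + 1) ^ (-(3 / 2) : ℝ) :=
    Real.rpow_le_rpow_of_exponent_le (by linarith) (by linarith)
  refine h0.trans ?_
  have key : ∀ y : ℝ, 0 < y → y ^ (-(1 / 2) : ℝ) = (√y)⁻¹ := fun y hy => by
    rw [Real.rpow_neg hy.le, Real.sqrt_eq_rpow]
  have e3 : (x + 1) ^ (-(3 / 2) : ℝ) = (x + 1)⁻¹ * (√(x + 1))⁻¹ := by
    rw [← key _ (by linarith), ← Real.rpow_neg_one, ← Real.rpow_add (by linarith)]; norm_num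
  rw [e3, key x (by linarith), key (x + 1) (by linarith)]
  set a := √x
  set b := √(x + 1)
  have ha : 0 < a := Real.sqrt_pos.2 (by linarith)
  have hb : 0 < b := Real.sqrt_pos.2 (by linarith)
  have hab : a ≤ b := Real.sqrt_le_sqrt (by linarith)
  have ha2 : a ^ 2 = x := Real.sq_sqrt (by linarith)
  have hb2 : b ^ 2 = x + 1 := Real.sq_sqrt (by linarith)
  rw [← hb2, inv_sub_inv ha.ne' hb.ne', ← mul_inv, ← one_div, mul_div_assoc',
    div_le_div_iff₀ (by positivity) (by positivity)]
  have : (b - a) * (b + a) = 1 := by nlinarith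
  have h2 : 1 ≤ (b - a) * (2 * b) := by nlinarith [sub_nonneg.2 hab]
  nlinarith [mul_le_mul_of_nonneg_left h2 (sq_nonneg b), mul_le_mul_of_nonneg_right hab hb.le]

lemma sum_tail_rpow_le {σ : ℝ} (hσ : 1 / 2 ≤ σ) (N M : ℕ) :
    ∑ n ∈ Finset.range M, (((N + n : ℕ) : ℝ) + 1) ^ (-σ - 1)
      ≤ 3 * ((N : ℝ) + 1) ^ (-(1 / 2) : ℝ) := by
  have hstep : ∑ n ∈ Finset.range M, (((N + (n + 1) : ℕ) : ℝ) + 1) ^ (-σ - 1)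
      ≤ 2 * ((N : ℝ) + 1) ^ (-(1 / 2) : ℝ) := by
    calc _ ≤ ∑ n ∈ Finset.range M, 2 * ((((N + n : ℕ) : ℝ) + 1) ^ (-(1 / 2) : ℝ)
            - (((N + (n + 1) : ℕ) : ℝ) + 1) ^ (-(1 / 2) : ℝ)) := by
          refine Finset.sum_le_sum fun n _ => ?_
          have := rpow_le_two_mul_sub (((N + n : ℕ) : ℝ) + 1)
            (by linarith [(N + n).cast_nonneg (α := ℝ)]) hσ
          push_cast at this ⊢
          simpa only [add_assoc] using this
      _ ≤ _ := by
          rw [← Finset.mul_sum, Finset.sum_range_sub' (fun n : ℕ =>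
            (((N + n : ℕ) : ℝ) + 1) ^ (-(1 / 2) : ℝ))]
          have : 0 ≤ (((N + M : ℕ) : ℝ) + 1) ^ (-(1 / 2) : ℝ) := by positivity
          simp only [add_zero]
          linarith
  have hle : ((N : ℝ) + 1) ^ (-σ - 1) ≤ ((N : ℝ) + 1) ^ (-(1 / 2) : ℝ) :=
    Real.rpow_le_rpow_of_exponent_le (by linarith [N.cast_nonneg (α := ℝ)]) (by linarith)
  calc _ ≤ ∑ n ∈ Finset.range (M + 1), (((N + n : ℕ) : ℝ) + 1) ^ (-σ - 1) := by
        rw [Finset.sum_range_succ]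
        have : 0 ≤ (((N + M : ℕ) : ℝ) + 1) ^ (-σ - 1) := by positivity
        linarith
    _ ≤ _ := by
        rw [Finset.sum_range_succ']
        simp only [add_zero]
        linarith

lemma summable_nat_add_one_rpow {p : ℝ} (hp : p < -1) :
    Summable fun n : ℕ => ((n : ℝ) + 1) ^ p := by
  have := (summable_nat_add_iff 1).2 (Real.summable_nat_rpow.2 hp)
  simpa using this

lemma summable_zetaTerm {s : ℂ} (hs : 0 < s.re) : Summable fun n => zetaTerm n s :=
  Summable.of_norm_bounded
    ((summable_nat_add_one_rpow (by linarith : -s.re - 1 < -1)).mul_left (‖s - 1‖ * ‖s‖))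
    fun n => norm_zetaTerm_le n hs

lemma sum_zetaTerm (s : ℂ) (N : ℕ) :
    ∑ n ∈ Finset.range N, zetaTerm n s
      = (s - 1) * ∑ n ∈ Finset.range N, ((n + 1 : ℕ) : ℂ) ^ (-s)
        + ((N + 1 : ℕ) : ℂ) ^ (1 - s) - 1 := by
  induction N with
  | zero => simp
  | succ N ih => rw [Finset.sum_range_succ, ih, Finset.sum_range_succ, zetaTerm]; push_cast; ring_nf

lemma riemannZeta₁_eq_of_one_lt_re {s : ℂ} (hs : 1 < s.re) :
    riemannZeta₁ s = 1 + ∑' n, zetaTerm n s := by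
  have hs1 : s ≠ 1 := fun h => by simp [h] at hs
  have h1 : riemannZeta₁ s = (s - 1) * riemannZeta s := by
    rw [riemannZeta_eq_inv_sub_mul hs1, mul_inv_cancel_left₀ (sub_ne_zero.2 hs1)]
  have h2 := (summable_zetaTerm (by linarith : 0 < s.re)).hasSum.tendsto_sum_nat
  simp_rw [sum_zetaTerm] at h2
  have hz : HasSum (fun n : ℕ => ((n + 1 : ℕ) : ℂ) ^ (-s)) (riemannZeta s) := by
    rw [zeta_eq_tsum_one_div_nat_add_one_cpow hs]
    have hsum : Summable fun n : ℕ => 1 / ((n : ℂ) + 1) ^ s := by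
      simpa using (summable_nat_add_iff 1).2 (Complex.summable_one_div_nat_cpow.2 hs)
    convert hsum.hasSum using 2 with n
    rw [cpow_neg, one_div]; push_cast; rfl
  have h3 : Tendsto (fun N : ℕ => ((N + 1 : ℕ) : ℂ) ^ (1 - s)) atTop (nhds 0) := by
    rw [tendsto_zero_iff_norm_tendsto_zero]
    have : ∀ N : ℕ, ‖((N + 1 : ℕ) : ℂ) ^ (1 - s)‖ = ((N + 1 : ℕ) : ℝ) ^ (-(s.re - 1)) :=
      fun N => by
        rw [norm_natCast_cpow_of_pos N.succ_pos]; simp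
    simp_rw [this]
    exact (tendsto_rpow_neg_atTop (by linarith)).comp
      (tendsto_natCast_atTop_atTop.comp (tendsto_add_atTop_nat 1))
  have h4 := ((hz.tendsto_sum_nat.const_mul (s - 1)).add h3).sub_const 1
  have := tendsto_nhds_unique h2 h4
  rw [h1, this]; ring

lemma riemannZeta₁_eq {s : ℂ} (hs : 1 / 4 < s.re) :
    riemannZeta₁ s = 1 + ∑' n, zetaTerm n s := by
  set R : ℝ := ‖s‖ + 3
  set D : Set ℂ := {z | 1 / 4 < z.re} ∩ Metric.ball 0 R with hD
  have hDo : IsOpen D := (isOpen_lt continuous_const continuous_re).inter Metric.isOpen_ball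
  have hDc : IsPreconnected D :=
    ((convex_halfSpace_re_gt (1 / 4)).inter (convex_ball 0 R)).isPreconnected
  have hbd : ∀ n : ℕ, ∀ w ∈ D, ‖zetaTerm n w‖ ≤ (R + 1) * R * ((n : ℝ) + 1) ^ (-(5 / 4) : ℝ) := by
    rintro n w ⟨hw1, hw2⟩
    have hw1 : 1 / 4 < w.re := hw1
    rw [mem_ball_zero_iff] at hw2
    refine (norm_zetaTerm_le n (by linarith)).trans ?_
    have : ‖w - 1‖ ≤ R + 1 := (norm_sub_le _ _).trans (by rw [norm_one]; linarith)
    have h2 : ((n : ℝ) + 1) ^ (-w.re - 1) ≤ ((n : ℝ) + 1) ^ (-(5 / 4) : ℝ) :=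
      Real.rpow_le_rpow_of_exponent_le (by linarith [n.cast_nonneg (α := ℝ)]) (by linarith)
    gcongr
  have hd : DifferentiableOn ℂ (fun w => 1 + ∑' n, zetaTerm n w) D :=
    (differentiableOn_const 1).add (differentiableOn_tsum_of_summable_norm
      ((summable_nat_add_one_rpow (by norm_num : (-(5 / 4) : ℝ) < -1)).mul_left ((R + 1) * R))
      (fun n => (differentiable_zetaTerm n).differentiableOn) hDo hbd)
  have h2 : (2 : ℂ) ∈ D := by
    refine ⟨by simp; norm_num, ?_⟩
    rw [mem_ball_zero_iff]; simp only [Complex.norm_ofNat, R]; linarith [norm_nonneg s]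
  have hev : riemannZeta₁ =ᶠ[nhds 2] fun w => 1 + ∑' n, zetaTerm n w := by
    filter_upwards [(isOpen_lt continuous_const continuous_re).mem_nhds
      (show (1 : ℝ) < (2 : ℂ).re by simp)] with w hw
    exact riemannZeta₁_eq_of_one_lt_re hw
  exact (differentiable_riemannZeta₁.differentiableOn.analyticOnNhd hDo).eqOn_of_preconnected_of_eventuallyEq
    (hd.analyticOnNhd hDo) hDc h2 hev
    ⟨hs, by rw [mem_ball_zero_iff]; simp only [R]; linarith⟩

/-- Truncated Dirichlet series of `ζ` to the right of the critical line. -/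
lemma norm_riemannZeta_sub_sum_le {s : ℂ} (hs : 1 / 2 ≤ s.re) (hs1 : s ≠ 1) (N : ℕ) :
    ‖riemannZeta s - ∑ n ∈ Finset.range N, ((n + 1 : ℕ) : ℂ) ^ (-s)
      - ((N + 1 : ℕ) : ℂ) ^ (1 - s) / (s - 1)‖ ≤ 3 * ‖s‖ * ((N : ℝ) + 1) ^ (-(1 / 2) : ℝ) := by
  have hne : s - 1 ≠ 0 := sub_ne_zero.2 hs1
  have hsum := summable_zetaTerm (by linarith : 0 < s.re)
  have h1 := riemannZeta₁_eq (by linarith : 1 / 4 < s.re)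
  rw [← hsum.sum_add_tsum_nat_add N, sum_zetaTerm] at h1
  have h2 : riemannZeta s - ∑ n ∈ Finset.range N, ((n + 1 : ℕ) : ℂ) ^ (-s)
      - ((N + 1 : ℕ) : ℂ) ^ (1 - s) / (s - 1) = (∑' n, zetaTerm (n + N) s) / (s - 1) := by
    rw [riemannZeta_eq_inv_sub_mul hs1, h1]; field_simp; ring
  rw [h2, norm_div, div_le_iff₀ (norm_pos_iff.2 hne)]
  have hb : ∀ n, ‖zetaTerm (n + N) s‖
      ≤ ‖s - 1‖ * ‖s‖ * (((n + N : ℕ) : ℝ) + 1) ^ (-s.re - 1) :=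
    fun n => norm_zetaTerm_le (n + N) (by linarith)
  have hs2 : Summable fun n : ℕ => (((n + N : ℕ) : ℝ) + 1) ^ (-s.re - 1) :=
    (summable_nat_add_iff N).2 (summable_nat_add_one_rpow (by linarith : -s.re - 1 < -1))
  refine (tsum_of_norm_bounded (hs2.mul_left _).hasSum hb).trans ?_
  rw [tsum_mul_left]
  have : ∑' n : ℕ, (((n + N : ℕ) : ℝ) + 1) ^ (-s.re - 1)
      ≤ 3 * ((N : ℝ) + 1) ^ (-(1 / 2) : ℝ) :=
    Real.tsum_le_of_sum_range_le (fun n => by positivity) fun M => by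
      simpa only [add_comm N] using sum_tail_rpow_le hs N M
  calc _ ≤ ‖s - 1‖ * ‖s‖ * (3 * ((N : ℝ) + 1) ^ (-(1 / 2) : ℝ)) := by gcongr
    _ = _ := by ring

lemma norm_riemannZeta_le {s : ℂ} (hs : 1 / 2 ≤ s.re) (hs1 : s ≠ 1) :
    ‖riemannZeta s‖ ≤ ‖s - 1‖⁻¹ + 3 * ‖s‖ := by
  have h := norm_riemannZeta_sub_sum_le hs hs1 0
  simp only [Finset.range_zero, Finset.sum_empty, sub_zero, zero_add, Nat.cast_one, one_cpow,
    Nat.cast_zero, Real.one_rpow, mul_one] at h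
  calc ‖riemannZeta s‖ = ‖1 / (s - 1) + (riemannZeta s - 1 / (s - 1))‖ := by rw [add_sub_cancel]
    _ ≤ ‖1 / (s - 1)‖ + 3 * ‖s‖ := (norm_add_le _ _).trans (by gcongr)
    _ = _ := by rw [norm_div, norm_one, one_div]

/-- The additive character `e^{2πix}`. -/
noncomputable def ee (x : ℝ) : ℂ := cexp ((2 * Real.pi * x : ℝ) * I)

lemma norm_ee (x : ℝ) : ‖ee x‖ = 1 := norm_exp_ofReal_mul_I _

lemma ee_add (x y : ℝ) : ee (x + y) = ee x * ee y := by
  rw [ee, ee, ee, ← Complex.exp_add]; congr 1; push_cast; ring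

lemma conj_ee (x : ℝ) : (starRingEnd ℂ) (ee x) = ee (-x) := by
  rw [ee, ee, ← exp_conj, map_mul, conj_ofReal, conj_I]; congr 1; push_cast; ring

lemma ee_intCast (k : ℤ) : ee k = 1 := by
  rw [ee, ← Complex.exp_int_mul_two_pi_mul_I k]; congr 1; push_cast; ring

lemma inv_one_sub_ee {x : ℝ} (hx : Real.sin (Real.pi * x) ≠ 0) :
    (1 - ee x)⁻¹
      = 1 / 2 + ((Real.cos (Real.pi * x) / Real.sin (Real.pi * x) / 2 : ℝ) : ℂ) * I := by
  have hs : ((Real.sin (Real.pi * x) : ℝ) : ℂ) ≠ 0 := by exact_mod_cast hx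
  have h : ee x = ((Real.cos (Real.pi * x) : ℝ) + (Real.sin (Real.pi * x) : ℝ) * I) ^ 2 := by
    rw [ofReal_cos, ofReal_sin, ← Complex.exp_mul_I, ← Complex.exp_nat_mul, ee]
    congr 1; push_cast; ring
  have hcs : ((Real.cos (Real.pi * x) : ℝ) : ℂ) ^ 2 + ((Real.sin (Real.pi * x) : ℝ) : ℂ) ^ 2 = 1 := by
    exact_mod_cast Real.cos_sq_add_sin_sq _
  apply inv_eq_of_mul_eq_one_right
  rw [h, ofReal_div, ofReal_div, ofReal_ofNat]
  generalize ((Real.sin (Real.pi * x) : ℝ) : ℂ) = s at *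
  generalize ((Real.cos (Real.pi * x) : ℝ) : ℂ) = c at *
  have h1 : 1 - (c + s * I) ^ 2 = 2 * s * (s - c * I) := by
    linear_combination (-1 : ℂ) * hcs - s ^ 2 * I_sq
  rw [h1]
  field_simp
  linear_combination hcs - c ^ 2 * I_sq

lemma two_mul_le_sin_pi_mul {θ x : ℝ} (h1 : θ ≤ x) (h2 : x ≤ 1 - θ) (hθ : 0 < θ) :
    2 * θ ≤ Real.sin (Real.pi * x) := by
  have hpi := Real.pi_pos
  rcases le_total x (1 / 2) with h | h
  · have := Real.mul_le_sin (x := Real.pi * x) (by nlinarith) (by nlinarith)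
    rw [show 2 / Real.pi * (Real.pi * x) = 2 * x by field_simp] at this
    linarith
  · have := Real.mul_le_sin (x := Real.pi * (1 - x)) (by nlinarith) (by nlinarith)
    rw [show 2 / Real.pi * (Real.pi * (1 - x)) = 2 * (1 - x) by field_simp,
      show Real.pi * (1 - x) = Real.pi - Real.pi * x by ring, Real.sin_pi_sub] at this
    linarith

lemma cot_antitone_aux {x y : ℝ} (hx : 0 < x) (hxy : x ≤ y) (hy : y < 1) :
    Real.cos (Real.pi * y) / Real.sin (Real.pi * y)
      ≤ Real.cos (Real.pi * x) / Real.sin (Real.pi * x) := by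
  have hpi := Real.pi_pos
  have h1 : 0 < Real.sin (Real.pi * x) := Real.sin_pos_of_pos_of_lt_pi (by positivity) (by nlinarith)
  have h2 : 0 < Real.sin (Real.pi * y) :=
    Real.sin_pos_of_pos_of_lt_pi (by nlinarith) (by nlinarith)
  rw [div_le_div_iff₀ h2 h1]
  have := Real.sin_nonneg_of_nonneg_of_le_pi (x := Real.pi * y - Real.pi * x)
    (by nlinarith) (by nlinarith)
  rw [Real.sin_sub] at this
  linarith

lemma kuzmin_landau_zero {f : ℕ → ℝ} {θ : ℝ} (hθ : 0 < θ) {m : ℕ}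
    (hlo : ∀ n < m, θ ≤ f (n + 1) - f n) (hhi : ∀ n < m, f (n + 1) - f n ≤ 1 - θ)
    (hmono : ∀ n, n + 1 < m → f (n + 1) - f n ≤ f (n + 2) - f (n + 1)) :
    ‖∑ n ∈ Finset.range m, ee (f n)‖ ≤ 1 / θ := by
  rcases m with _ | m
  · simp [hθ.le]
  set d : ℕ → ℝ := fun n => f (n + 1) - f n with hd
  set κ : ℕ → ℝ := fun n => Real.cos (Real.pi * d n) / Real.sin (Real.pi * d n) with hκ
  set c : ℕ → ℂ := fun n => (1 - ee (d n))⁻¹ with hc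
  have hsin : ∀ n < m + 1, 2 * θ ≤ Real.sin (Real.pi * d n) := fun n hn =>
    two_mul_le_sin_pi_mul (hlo n hn) (hhi n hn) hθ
  have hcκ : ∀ n < m + 1, c n = 1 / 2 + ((κ n / 2 : ℝ) : ℂ) * I := fun n hn =>
    inv_one_sub_ee (by linarith [hsin n hn] : 0 < Real.sin (Real.pi * d n)).ne'
  have hee : ∀ n < m + 1, ee (f n) = (ee (f n) - ee (f (n + 1))) * c n := fun n hn => by
    have hne : 1 - ee (d n) ≠ 0 := by
      intro h
      have := hcκ n hn
      simp only [hc, h, inv_zero] at this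
      have := congrArg Complex.re this
      simp at this
    have : f (n + 1) = f n + d n := by simp [hd]
    rw [this, ee_add, ← mul_one_sub, mul_assoc]
    simp only [hc, mul_inv_cancel₀ hne, mul_one]
  have main : ∀ k ≤ m, ‖∑ n ∈ Finset.range (k + 1), ee (f n) + ee (f (k + 1)) * c k
      - ee (f 0) * c 0‖ ≤ (κ 0 - κ k) / 2 := by
    intro k
    induction k with
    | zero =>
      intro _
      have h0 : ∑ n ∈ Finset.range (0 + 1), ee (f n) + ee (f (0 + 1)) * c 0 - ee (f 0) * c 0 = 0 := by
        rw [zero_add, Finset.sum_range_one]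
        linear_combination hee 0 (by omega)
      rw [h0]; simp
    | succ k ih =>
      intro hk
      have h1 := ih (by omega)
      have h2 : ∑ n ∈ Finset.range (k + 1 + 1), ee (f n) + ee (f (k + 1 + 1)) * c (k + 1)
          - ee (f 0) * c 0 = (∑ n ∈ Finset.range (k + 1), ee (f n) + ee (f (k + 1)) * c k
      - ee (f 0) * c 0) + ee (f (k + 1)) * (c (k + 1) - c k) := by
        rw [Finset.sum_range_succ]
        linear_combination hee (k + 1) (by omega)
      rw [h2]
      have h3 : κ (k + 1) ≤ κ k := cot_antitone_aux (by linarith [hlo k (by omega)])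
        (hmono k (by omega)) (by have := hhi (k + 1) (by omega); simp only [hd]; linarith)
      have h4 : ‖ee (f (k + 1)) * (c (k + 1) - c k)‖ = (κ k - κ (k + 1)) / 2 := by
        rw [norm_mul, norm_ee, one_mul, hcκ (k + 1) (by omega), hcκ k (by omega)]
        rw [show (1 / 2 + ((κ (k + 1) / 2 : ℝ) : ℂ) * I - (1 / 2 + ((κ k / 2 : ℝ) : ℂ) * I))
          = (((κ (k + 1) - κ k) / 2 : ℝ) : ℂ) * I by push_cast; ring, norm_mul, norm_I, mul_one,
          norm_real, Real.norm_eq_abs, abs_of_nonpos (by linarith)]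
        ring
      refine (norm_add_le _ _).trans ?_
      rw [h4]; linarith
  have hκb : ∀ n < m + 1, |κ n| ≤ 1 / (2 * θ) := fun n hn => by
    have h := hsin n hn
    have h0 : 0 < Real.sin (Real.pi * d n) := by linarith
    simp only [hκ]
    rw [abs_div, abs_of_pos h0]
    exact div_le_div₀ zero_le_one (Real.abs_cos_le_one _) (by positivity) h
  have hcb : ∀ n < m + 1, ‖c n‖ ≤ 1 / (4 * θ) := fun n hn => by
    have h := hsin n hn
    have h0 : 0 < Real.sin (Real.pi * d n) := by linarith
    have h1 : ‖c n‖ ^ 2 = (1 / (2 * Real.sin (Real.pi * d n))) ^ 2 := by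
      rw [hcκ n hn, ← normSq_eq_norm_sq, show (1 / 2 + ((κ n / 2 : ℝ) : ℂ) * I)
        = ((1 / 2 : ℝ) : ℂ) + ((κ n / 2 : ℝ) : ℂ) * I by push_cast; rfl, normSq_add_mul_I]
      simp only [hκ]
      have := Real.sin_sq_add_cos_sq (Real.pi * d n)
      field_simp
      linarith
    have h2 : ‖c n‖ = 1 / (2 * Real.sin (Real.pi * d n)) :=
      (pow_left_inj₀ (norm_nonneg _) (by positivity) two_ne_zero).1 h1
    rw [h2]
    exact one_div_le_one_div_of_le (by positivity) (by linarith)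
  have e1 := main m le_rfl
  have e2 := hκb 0 (by omega)
  have e3 := hκb m (by omega)
  rw [abs_le] at e2 e3
  calc ‖∑ n ∈ Finset.range (m + 1), ee (f n)‖
      = ‖(∑ n ∈ Finset.range (m + 1), ee (f n) + ee (f (m + 1)) * c m - ee (f 0) * c 0)
        - ee (f (m + 1)) * c m + ee (f 0) * c 0‖ := by congr 1; ring
    _ ≤ (κ 0 - κ m) / 2 + ‖ee (f (m + 1)) * c m‖ + ‖ee (f 0) * c 0‖ :=
        (norm_add_le _ _).trans (by gcongr; exact (norm_sub_le _ _).trans (by gcongr))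
    _ ≤ (κ 0 - κ m) / 2 + 1 / (4 * θ) + 1 / (4 * θ) := by
        rw [norm_mul, norm_mul, norm_ee, norm_ee, one_mul, one_mul]
        gcongr
        · exact hcb m (by omega)
        · exact hcb 0 (by omega)
    _ ≤ _ := by
        have : (1 / (2 * θ) + 1 / (2 * θ)) / 2 + 1 / (4 * θ) + 1 / (4 * θ) = 1 / θ := by
          field_simp; norm_num
        rw [← this]; gcongr; linarith

/-- The Kuzmin-Landau inequality. -/
lemma kuzmin_landau {f : ℕ → ℝ} {θ : ℝ} (hθ : 0 < θ) (k : ℤ) {a b : ℕ}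
    (hlo : ∀ n, a ≤ n → n < b → k + θ ≤ f (n + 1) - f n)
    (hhi : ∀ n, a ≤ n → n < b → f (n + 1) - f n ≤ k + 1 - θ)
    (hmono : ∀ n, a ≤ n → n + 1 < b → f (n + 1) - f n ≤ f (n + 2) - f (n + 1)) :
    ‖∑ n ∈ Finset.Ico a b, ee (f n)‖ ≤ 1 / θ := by
  rw [Finset.sum_Ico_eq_sum_range]
  have h := kuzmin_landau_zero (f := fun n => f (a + n) - k * n) hθ (m := b - a)
    (fun n hn => by
      have := hlo (a + n) (by omega) (by omega)
      push_cast; rw [← add_assoc]; linarith)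
    (fun n hn => by
      have := hhi (a + n) (by omega) (by omega)
      push_cast; rw [← add_assoc]; linarith)
    (fun n hn => by
      have := hmono (a + n) (by omega) (by omega)
      push_cast; rw [← add_assoc, ← add_assoc]; linarith)
  convert h using 3 with n
  rw [sub_eq_add_neg, ee_add, show -((k : ℝ) * (n : ℝ)) = ((-(k * n) : ℤ) : ℝ) by push_cast; ring,
    ee_intCast, mul_one]

lemma exists_filter_Ico_eq_Ico {d : ℕ → ℝ} {a b : ℕ}
    (hmono : ∀ m n, a ≤ m → m ≤ n → n < b → d m ≤ d n) (x y : ℝ) :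
    ∃ a' b', a ≤ a' ∧ b' ≤ b ∧
      (Finset.Ico a b).filter (fun n => x ≤ d n ∧ d n ≤ y) = Finset.Ico a' b' := by
  set S := (Finset.Ico a b).filter (fun n => x ≤ d n ∧ d n ≤ y) with hS
  rcases S.eq_empty_or_nonempty with h | h
  · exact ⟨max a b, b, le_max_left _ _, le_rfl, by rw [h]; simp⟩
  have h1 := S.min'_mem h
  have h2 := S.max'_mem h
  have h1' := h1
  have h2' := h2
  simp only [hS, Finset.mem_filter, Finset.mem_Ico] at h1' h2'
  refine ⟨S.min' h, S.max' h + 1, h1'.1.1, h2'.1.2, ?_⟩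
  ext n
  rw [Finset.mem_Ico]
  constructor
  · intro hn
    exact ⟨S.min'_le n hn, Nat.lt_succ_of_le (S.le_max' n hn)⟩
  · rintro ⟨hn1, hn2⟩
    have hn2 := Nat.le_of_lt_succ hn2
    simp only [hS, Finset.mem_filter, Finset.mem_Ico]
    refine ⟨⟨h1'.1.1.trans hn1, hn2.trans_lt h2'.1.2⟩, h1'.2.1.trans (hmono _ _ h1'.1.1 hn1
      (hn2.trans_lt h2'.1.2)), (hmono _ _ (h1'.1.1.trans hn1) hn2 h2'.1.2).trans h2'.2.2⟩

lemma add_mul_le_of_step {d : ℕ → ℝ} {a b : ℕ} {δ : ℝ}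
    (hstep : ∀ n, a ≤ n → n + 1 < b → d n + δ ≤ d (n + 1)) (m n : ℕ) (hm : a ≤ m) (hmn : m ≤ n)
    (hn : n < b) : d m + ((n : ℝ) - m) * δ ≤ d n := by
  induction n, hmn using Nat.le_induction with
  | base => simp
  | succ n hmn ih =>
    have h1 := ih (by omega)
    have h2 := hstep n (by omega) hn
    push_cast
    linarith

lemma card_filter_Ico_le {d : ℕ → ℝ} {a b : ℕ} {δ θ x : ℝ} (hδ : 0 < δ) (hθ : 0 ≤ θ)
    (hstep : ∀ n, a ≤ n → n + 1 < b → d n + δ ≤ d (n + 1)) :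
    (((Finset.Ico a b).filter (fun n => x ≤ d n ∧ d n ≤ x + θ)).card : ℝ) ≤ θ / δ + 1 := by
  set S := (Finset.Ico a b).filter (fun n => x ≤ d n ∧ d n ≤ x + θ) with hS
  rcases S.eq_empty_or_nonempty with h | h
  · rw [h]; simp; positivity
  have h1 := S.min'_mem h
  have h2 := S.max'_mem h
  have hle : S.min' h ≤ S.max' h := S.min'_le_max' h
  have hsub : S ⊆ Finset.Icc (S.min' h) (S.max' h) := fun n hn =>
    Finset.mem_Icc.2 ⟨S.min'_le n hn, S.le_max' n hn⟩
  have hc := Finset.card_le_card hsub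
  rw [Nat.card_Icc] at hc
  have hc' : (S.card : ℝ) ≤ (S.max' h : ℝ) - S.min' h + 1 := by
    have : S.card + S.min' h ≤ S.max' h + 1 := by omega
    have : (S.card : ℝ) + S.min' h ≤ S.max' h + 1 := by exact_mod_cast this
    linarith
  generalize S.min' h = p at *
  generalize S.max' h = q at *
  simp only [hS, Finset.mem_filter, Finset.mem_Ico] at h1 h2
  have := add_mul_le_of_step hstep p q h1.1.1 hle h2.1.2
  have h3 : ((q : ℝ) - p) ≤ θ / δ := by
    rw [le_div_iff₀ hδ]; linarith [h1.2.1, h2.2.2]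
  linarith

/-- The second derivative test with a free parameter `θ`. -/
lemma norm_sum_ee_le_of_step {f : ℕ → ℝ} {a b : ℕ} {δ θ V : ℝ} (hδ : 0 < δ) (hθ : 0 < θ)
    (hV : 0 ≤ V)
    (hstep : ∀ n, a ≤ n → n + 1 < b → f (n + 1) - f n + δ ≤ f (n + 2) - f (n + 1))
    (hvar : ∀ n, a ≤ n → n < b → f (n + 1) - f n ≤ f (a + 1) - f a + V) :
    ‖∑ n ∈ Finset.Ico a b, ee (f n)‖ ≤ (V + 2) * (1 / θ + 2 * (θ / δ + 1)) := by
  set d : ℕ → ℝ := fun n => f (n + 1) - f n with hd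
  have hstep' : ∀ n, a ≤ n → n + 1 < b → d n + δ ≤ d (n + 1) := hstep
  have hmono : ∀ m n, a ≤ m → m ≤ n → n < b → d m ≤ d n := fun m n hm hmn hn => by
    have := add_mul_le_of_step hstep' m n hm hmn hn
    have h2 : (0 : ℝ) ≤ (n : ℝ) - m := by
      rw [sub_nonneg]; exact_mod_cast hmn
    nlinarith
  have hmaps : ∀ n ∈ Finset.Ico a b, ⌊d n⌋ ∈ Finset.Icc ⌊d a⌋ ⌊d a + V⌋ := fun n hn => by
    rw [Finset.mem_Ico] at hn
    rw [Finset.mem_Icc]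
    exact ⟨Int.floor_le_floor (hmono a n le_rfl hn.1 hn.2), Int.floor_le_floor (hvar n hn.1 hn.2)⟩
  have hfib : ∀ k : ℤ, ‖∑ n ∈ Finset.Ico a b with ⌊d n⌋ = k, ee (f n)‖
      ≤ 1 / θ + 2 * (θ / δ + 1) := by
    intro k
    set S := (Finset.Ico a b).filter (fun n => ⌊d n⌋ = k) with hS
    rw [← Finset.sum_filter_add_sum_filter_not S (fun n => k + θ ≤ d n ∧ d n ≤ k + 1 - θ)]
    refine (norm_add_le _ _).trans (add_le_add ?_ ?_)
    · have hSe : S.filter (fun n => k + θ ≤ d n ∧ d n ≤ k + 1 - θ)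
          = (Finset.Ico a b).filter (fun n => k + θ ≤ d n ∧ d n ≤ k + 1 - θ) := by
        ext n
        simp only [hS, Finset.mem_filter, and_assoc, and_congr_right_iff]
        intro _
        refine ⟨fun h => h.2, fun h => ⟨?_, h⟩⟩
        rw [Int.floor_eq_iff]
        exact ⟨by linarith [h.1], by linarith [h.2]⟩
      obtain ⟨a', b', ha', hb', he⟩ := exists_filter_Ico_eq_Ico hmono (k + θ) (k + 1 - θ)
      have hmem : ∀ n, a' ≤ n → n < b' → k + θ ≤ d n ∧ d n ≤ k + 1 - θ := fun n h1 h2 => by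
        have : n ∈ Finset.Ico a' b' := Finset.mem_Ico.2 ⟨h1, h2⟩
        rw [← he, Finset.mem_filter] at this
        exact this.2
      rw [hSe, he]
      exact kuzmin_landau hθ k (fun n h1 h2 => (hmem n h1 h2).1) (fun n h1 h2 => (hmem n h1 h2).2)
        (fun n h1 h2 => hmono n (n + 1) (by omega) (by omega) (by omega))
    · refine (norm_sum_le _ _).trans ?_
      simp only [norm_ee, Finset.sum_const, nsmul_eq_mul, mul_one]
      have hsub : S.filter (fun n => ¬ (k + θ ≤ d n ∧ d n ≤ k + 1 - θ))
          ⊆ (Finset.Ico a b).filter (fun n => (k : ℝ) ≤ d n ∧ d n ≤ k + θ)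
            ∪ (Finset.Ico a b).filter (fun n => k + 1 - θ ≤ d n ∧ d n ≤ k + 1 - θ + θ) := by
        intro n hn
        simp only [hS, Finset.mem_filter, Finset.mem_union] at hn ⊢
        obtain ⟨⟨h1, h2⟩, h3⟩ := hn
        rw [Int.floor_eq_iff] at h2
        rw [not_and_or, not_le, not_le] at h3
        rcases h3 with h3 | h3
        · exact Or.inl ⟨h1, h2.1, h3.le⟩
        · exact Or.inr ⟨h1, h3.le, by linarith [h2.2]⟩
      have hc := (Finset.card_le_card hsub).trans (Finset.card_union_le _ _)
      have hc' : ((S.filter (fun n => ¬ (k + θ ≤ d n ∧ d n ≤ k + 1 - θ))).card : ℝ)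
          ≤ ((Finset.Ico a b).filter (fun n => (k : ℝ) ≤ d n ∧ d n ≤ k + θ)).card
            + ((Finset.Ico a b).filter (fun n => k + 1 - θ ≤ d n ∧ d n ≤ k + 1 - θ + θ)).card := by
        exact_mod_cast hc
      have c1 := card_filter_Ico_le (x := k) hδ hθ.le hstep'
      have c2 := card_filter_Ico_le (x := k + 1 - θ) hδ hθ.le hstep'
      linarith
  rw [← Finset.sum_fiberwise_of_maps_to hmaps]
  refine (norm_sum_le _ _).trans ((Finset.sum_le_sum fun k _ => hfib k).trans ?_)
  rw [Finset.sum_const, nsmul_eq_mul, Int.card_Icc]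
  have h0 : 0 ≤ 1 / θ + 2 * (θ / δ + 1) := by positivity
  refine mul_le_mul_of_nonneg_right ?_ h0
  have hfl : ⌊d a⌋ ≤ ⌊d a + V⌋ := Int.floor_le_floor (by linarith)
  have : (((⌊d a + V⌋ + 1 - ⌊d a⌋).toNat : ℤ) : ℝ) = (⌊d a + V⌋ + 1 - ⌊d a⌋ : ℝ) := by
    rw [Int.toNat_of_nonneg (by omega)]; push_cast; ring
  rw [Int.cast_natCast] at this
  rw [this]
  have e1 := Int.floor_le (d a + V)
  have e2 := Int.lt_floor_add_one (d a)
  linarith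

/-- The second derivative test. -/
lemma norm_sum_ee_le {f : ℕ → ℝ} {a b : ℕ} {δ V : ℝ} (hδ : 0 < δ) (hV : 0 ≤ V)
    (hstep : ∀ n, a ≤ n → n + 1 < b → f (n + 1) - f n + δ ≤ f (n + 2) - f (n + 1))
    (hvar : ∀ n, a ≤ n → n < b → f (n + 1) - f n ≤ f (a + 1) - f a + V) :
    ‖∑ n ∈ Finset.Ico a b, ee (f n)‖ ≤ (V + 2) * (3 / √δ + 2) := by
  have h := norm_sum_ee_le_of_step hδ (Real.sqrt_pos.2 hδ) hV hstep hvar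
  have : 1 / √δ + 2 * (√δ / δ + 1) = 3 / √δ + 2 := by
    rw [Real.sqrt_div_self']; ring
  rwa [this] at h

/-- Van der Corput's differencing inequality. -/
lemma van_der_corput {z : ℕ → ℂ} (hz : ∀ n, ‖z n‖ ≤ 1) {N H : ℕ} {B : ℕ → ℝ}
    (hB : ∀ q r, 1 ≤ q → q + r < H →
      ‖∑ n ∈ Finset.range N, z (n + (q + r)) * (starRingEnd ℂ) (z (n + r))‖ ≤ B q) :
    H * ‖∑ n ∈ Finset.range N, z n‖
      ≤ H ^ 2 + √(N * H * (N + 2 * ∑ q ∈ Finset.Ico 1 H, B q)) := by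
  have hB0 : ∀ q, 1 ≤ q → q < H → 0 ≤ B q := fun q h1 h2 =>
    (norm_nonneg _).trans (hB q 0 h1 (by omega))
  set S := ∑ n ∈ Finset.range N, z n with hS
  have hshift : ∀ h : ℕ, ‖S - ∑ n ∈ Finset.range N, z (n + h)‖ ≤ 2 * h := by
    intro h
    have h1 : ∑ n ∈ Finset.range (N + h), z n = S + ∑ n ∈ Finset.range h, z (N + n) :=
      Finset.sum_range_add z N h
    have h2 : ∑ n ∈ Finset.range (h + N), z n
        = ∑ n ∈ Finset.range h, z n + ∑ n ∈ Finset.range N, z (h + n) :=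
      Finset.sum_range_add z h N
    rw [add_comm h N, h1] at h2
    have h3 : S - ∑ n ∈ Finset.range N, z (n + h)
        = ∑ n ∈ Finset.range h, z n - ∑ n ∈ Finset.range h, z (N + n) := by
      simp_rw [add_comm _ h]
      linear_combination h2
    have hb : ∀ w : ℕ → ℂ, (∀ n, ‖w n‖ ≤ 1) → ‖∑ n ∈ Finset.range h, w n‖ ≤ h := fun w hw =>
      (norm_sum_le_of_le _ fun n _ => hw n).trans (by simp)
    rw [h3]
    refine (norm_sub_le _ _).trans ?_
    linarith [hb z hz, hb (fun n => z (N + n)) fun n => hz _]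
  set W : ℕ → ℂ := fun n => ∑ h ∈ Finset.range H, z (n + h) with hW
  have h1 : ‖(H : ℂ) * S - ∑ n ∈ Finset.range N, W n‖ ≤ H ^ 2 := by
    have e1 : (H : ℂ) * S - ∑ n ∈ Finset.range N, W n
        = ∑ h ∈ Finset.range H, (S - ∑ n ∈ Finset.range N, z (n + h)) := by
      rw [Finset.sum_sub_distrib, Finset.sum_const, Finset.card_range, nsmul_eq_mul,
        Finset.sum_comm]
    rw [e1]
    refine (norm_sum_le_of_le _ fun h _ => hshift h).trans ?_
    rw [← Finset.mul_sum]
    have := Finset.sum_range_id_mul_two H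
    have : ((∑ i ∈ Finset.range H, i : ℕ) : ℝ) * 2 = (H * (H - 1) : ℕ) := by exact_mod_cast this
    rw [← Nat.cast_sum, mul_comm, this, sq]
    exact_mod_cast Nat.mul_le_mul_left H (Nat.sub_le H 1)
  have h2 : ‖∑ n ∈ Finset.range N, W n‖ ^ 2 ≤ N * ∑ n ∈ Finset.range N, ‖W n‖ ^ 2 := by
    calc _ ≤ (∑ n ∈ Finset.range N, ‖W n‖) ^ 2 := by gcongr; exact norm_sum_le _ _
      _ ≤ _ := by
        have := sq_sum_le_card_mul_sum_sq (s := Finset.range N) (f := fun n => ‖W n‖)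
        rwa [Finset.card_range] at this
  have h3 : (∑ n ∈ Finset.range N, ‖W n‖ ^ 2 : ℝ)
      ≤ H * (N + 2 * ∑ q ∈ Finset.Ico 1 H, B q) := by
    have e1 : ((∑ n ∈ Finset.range N, ‖W n‖ ^ 2 : ℝ) : ℂ)
        = ∑ h ∈ Finset.range H, ∑ h' ∈ Finset.range H,
          ∑ n ∈ Finset.range N, z (n + h) * (starRingEnd ℂ) (z (n + h')) := by
      push_cast
      have : ∀ n, ((‖W n‖ : ℂ)) ^ 2 = ∑ h ∈ Finset.range H, ∑ h' ∈ Finset.range H,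
          z (n + h) * (starRingEnd ℂ) (z (n + h')) := fun n => by
        rw [← Complex.mul_conj', hW]
        simp only [map_sum]
        rw [Finset.sum_mul_sum]
      simp_rw [this]
      rw [Finset.sum_comm]
      refine Finset.sum_congr rfl fun h _ => ?_
      rw [Finset.sum_comm]
    have e2 : ∀ h ∈ Finset.range H, ∑ h' ∈ Finset.range H,
        ‖∑ n ∈ Finset.range N, z (n + h) * (starRingEnd ℂ) (z (n + h'))‖
          ≤ N + 2 * ∑ q ∈ Finset.Ico 1 H, B q := by
      intro h hh
      rw [Finset.mem_range] at hh
      set F : ℕ → ℝ := fun h' =>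
        ‖∑ n ∈ Finset.range N, z (n + h) * (starRingEnd ℂ) (z (n + h'))‖ with hF
      have hlow : ∑ h' ∈ Finset.range h, F h' ≤ ∑ q ∈ Finset.Ico 1 H, B q := by
        rw [← Finset.sum_range_reflect]
        calc _ ≤ ∑ j ∈ Finset.range h, B (j + 1) := by
              refine Finset.sum_le_sum fun j hj => ?_
              rw [Finset.mem_range] at hj
              have := hB (j + 1) (h - 1 - j) (by omega) (by omega)
              rwa [show j + 1 + (h - 1 - j) = h by omega] at this
          _ = ∑ q ∈ Finset.Ico 1 (h + 1), B q := by
              rw [Finset.sum_Ico_eq_sum_range]; simp [add_comm]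
          _ ≤ _ := Finset.sum_le_sum_of_subset_of_nonneg
              (Finset.Ico_subset_Ico_right (by omega)) fun q hq _ => by
                rw [Finset.mem_Ico] at hq; exact hB0 q hq.1 hq.2
      have hhigh : ∑ h' ∈ Finset.Ico (h + 1) H, F h' ≤ ∑ q ∈ Finset.Ico 1 H, B q := by
        rw [Finset.sum_Ico_eq_sum_range]
        calc _ ≤ ∑ j ∈ Finset.range (H - (h + 1)), B (j + 1) := by
              refine Finset.sum_le_sum fun j hj => ?_
              rw [Finset.mem_range] at hj
              have := hB (j + 1) h (by omega) (by omega)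
              rw [← Complex.norm_conj, map_sum] at this
              simp only [map_mul, Complex.conj_conj] at this
              simp only [hF]
              simp only [mul_comm (z _)]
              rwa [show h + 1 + j = j + 1 + h by omega]
          _ = ∑ q ∈ Finset.Ico 1 (H - h), B q := by
              rw [Finset.sum_Ico_eq_sum_range, Nat.sub_sub]; simp [add_comm]
          _ ≤ _ := Finset.sum_le_sum_of_subset_of_nonneg
              (Finset.Ico_subset_Ico_right (by omega)) fun q hq _ => by
                rw [Finset.mem_Ico] at hq; exact hB0 q hq.1 hq.2
      have hmid : F h ≤ N := by
        refine (norm_sum_le_of_le _ (fun n _ => ?_ : ∀ n ∈ Finset.range N, _ ≤ (1 : ℝ))).trans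
          (by simp)
        rw [norm_mul, Complex.norm_conj]
        exact mul_le_one₀ (hz _) (norm_nonneg _) (hz _)
      rw [← Finset.sum_range_add_sum_Ico F hh.le, Finset.sum_eq_sum_Ico_succ_bot hh]
      linarith
    have e3 : (∑ n ∈ Finset.range N, ‖W n‖ ^ 2 : ℝ)
        = ‖((∑ n ∈ Finset.range N, ‖W n‖ ^ 2 : ℝ) : ℂ)‖ := by
      rw [norm_real, Real.norm_of_nonneg (Finset.sum_nonneg fun n _ => by positivity)]
    rw [e3, e1]
    refine (norm_sum_le_of_le _ fun h hh => (norm_sum_le _ _).trans (e2 h hh)).trans ?_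
    rw [Finset.sum_const, Finset.card_range, nsmul_eq_mul]
  have h4 : ‖∑ n ∈ Finset.range N, W n‖ ≤ √(N * H * (N + 2 * ∑ q ∈ Finset.Ico 1 H, B q)) := by
    apply Real.le_sqrt_of_sq_le
    calc _ ≤ _ := h2
      _ ≤ N * (H * (N + 2 * ∑ q ∈ Finset.Ico 1 H, B q)) := by gcongr
      _ = _ := by ring
  calc H * ‖S‖ = ‖(H : ℂ) * S‖ := by rw [norm_mul, Complex.norm_natCast]
    _ = ‖((H : ℂ) * S - ∑ n ∈ Finset.range N, W n) + ∑ n ∈ Finset.range N, W n‖ := by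
        congr 1; ring
    _ ≤ _ := (norm_add_le _ _).trans (add_le_add h1 h4)

lemma le_of_sq_le {x y : ℝ} (hy : 0 ≤ y) (h : x ^ 2 ≤ y ^ 2) : x ≤ y :=
  le_of_abs_le (abs_le_of_sq_le_sq h hy)

lemma norm_sum_ee_neg (S : Finset ℕ) (f : ℕ → ℝ) :
    ‖∑ n ∈ S, ee (-f n)‖ = ‖∑ n ∈ S, ee (f n)‖ := by
  rw [← Complex.norm_conj (∑ n ∈ S, ee (f n)), map_sum]
  simp_rw [conj_ee]

/-- Kuzmin-Landau for `n ^ (-2πiτ)` on a dyadic block. -/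
lemma norm_sum_ee_log_le_div {τ : ℝ} (hτ : 0 < τ) {A M : ℕ} (hA : 2 * τ ≤ A) (hM : M ≤ A) :
    ‖∑ n ∈ Finset.Ico A (A + M), ee (-(τ * Real.log n))‖ ≤ 2 * A / τ := by
  have hA0 : (0 : ℝ) < A := by linarith
  have hlog : ∀ n : ℕ, A ≤ n → Real.log ((n + 1 : ℕ) : ℝ) - Real.log n = Real.log (1 + 1 / n) :=
    fun n hn => by
      have hn0 : (0 : ℝ) < n := hA0.trans_le (by exact_mod_cast hn)
      rw [← Real.log_div (by positivity) hn0.ne']; congr 1; push_cast; field_simp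
  have hup : ∀ n : ℕ, A ≤ n → Real.log (1 + 1 / (n : ℝ)) ≤ 1 / A := fun n hn => by
    have hn0 : (A : ℝ) ≤ n := by exact_mod_cast hn
    have h0 : (0 : ℝ) < n := by linarith
    refine (Real.log_le_sub_one_of_pos (by positivity)).trans ?_
    rw [add_sub_cancel_left]
    exact one_div_le_one_div_of_le hA0 hn0
  have hlow : ∀ n : ℕ, A ≤ n → n < A + M → 1 / (2 * A : ℝ) ≤ Real.log (1 + 1 / (n : ℝ)) :=
    fun n hn hn' => by
    have hn0 : (A : ℝ) ≤ n := by exact_mod_cast hn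
    have h0 : (0 : ℝ) < n := by linarith
    have hn2 : (n : ℝ) + 1 ≤ 2 * A := by
      have : n + 1 ≤ 2 * A := by omega
      exact_mod_cast this
    refine le_trans ?_ (Real.one_sub_inv_le_log_of_pos (by positivity))
    have : 1 - (1 + 1 / (n : ℝ))⁻¹ = 1 / (n + 1) := by field_simp; ring
    rw [this]
    exact one_div_le_one_div_of_le (by positivity) hn2
  have h := kuzmin_landau (f := fun n : ℕ => -(τ * Real.log n)) (θ := τ / (2 * A))
    (by positivity) (-1) (a := A) (b := A + M)
    (fun n h1 h2 => by
      have h3 := hup n h1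
      rw [← hlog n h1] at h3
      have h4 := mul_le_mul_of_nonneg_left h3 hτ.le
      have h5 : τ * (1 / A) + τ / (2 * A) ≤ 1 := by
        have : τ * (1 / A) + τ / (2 * A) = (3 * τ) / (2 * A) := by field_simp; norm_num
        rw [this, div_le_one (by positivity)]; linarith
      push_cast at h4 ⊢
      linarith)
    (fun n h1 h2 => by
      have h3 := hlow n h1 h2
      rw [← hlog n h1] at h3
      have h4 := mul_le_mul_of_nonneg_left h3 hτ.le
      rw [mul_one_div] at h4
      push_cast at h4 ⊢
      linarith)
    (fun n h1 h2 => by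
      have hn0 : (A : ℝ) ≤ n := by exact_mod_cast h1
      have h3 : Real.log (1 + 1 / ((n + 1 : ℕ) : ℝ)) ≤ Real.log (1 + 1 / (n : ℝ)) := by
        apply Real.log_le_log (by positivity)
        gcongr
        · linarith
        · omega
      rw [← hlog n h1, ← hlog (n + 1) (by omega)] at h3
      have h4 := mul_le_mul_of_nonneg_left h3 hτ.le
      rw [show n + 1 + 1 = n + 2 by omega] at h4
      linarith)
  refine h.trans_eq ?_
  field_simp

/-- The second derivative test for `n ^ (-2πiτ)` on a dyadic block. -/
lemma norm_sum_ee_log_le_second {τ : ℝ} (hτ : 0 < τ) {A M : ℕ} (hA : 1 ≤ A) (hM : M ≤ A) :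
    ‖∑ n ∈ Finset.Ico A (A + M), ee (-(τ * Real.log n))‖ ≤ (τ / A + 2) * (6 * A / √τ + 2) := by
  have hA0 : (0 : ℝ) < A := by exact_mod_cast hA
  have hlog : ∀ n : ℕ, A ≤ n → Real.log ((n + 1 : ℕ) : ℝ) - Real.log n = Real.log (1 + 1 / n) :=
    fun n hn => by
      have hn0 : (0 : ℝ) < n := hA0.trans_le (by exact_mod_cast hn)
      rw [← Real.log_div (by positivity) hn0.ne']; congr 1; push_cast; field_simp
  have h := norm_sum_ee_le (f := fun n : ℕ => -(τ * Real.log n)) (a := A) (b := A + M)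
    (δ := τ / (4 * A ^ 2)) (V := τ / A) (by positivity) (by positivity)
    (fun n h1 h2 => by
      have hn0 : (A : ℝ) ≤ n := by exact_mod_cast h1
      have hp : (0 : ℝ) < n := by linarith
      have hn2 : (n : ℝ) + 1 ≤ 2 * A := by
        have : n + 1 ≤ 2 * A := by omega
        exact_mod_cast this
      have h3 : 1 / (4 * A ^ 2 : ℝ)
          ≤ Real.log (1 + 1 / (n : ℝ)) - Real.log (1 + 1 / ((n + 1 : ℕ) : ℝ)) := by
        rw [← Real.log_div (by positivity) (by positivity)]
        refine le_trans ?_ (Real.one_sub_inv_le_log_of_pos (by positivity))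
        have : 1 - ((1 + 1 / (n : ℝ)) / (1 + 1 / ((n + 1 : ℕ) : ℝ)))⁻¹ = 1 / ((n : ℝ) + 1) ^ 2 := by
          push_cast; field_simp; ring
        rw [this]
        apply one_div_le_one_div_of_le (by positivity)
        calc ((n : ℝ) + 1) ^ 2 ≤ (2 * A) ^ 2 := by gcongr
          _ = _ := by ring
      rw [← hlog n h1, ← hlog (n + 1) (by omega)] at h3
      have h4 := mul_le_mul_of_nonneg_left h3 hτ.le
      rw [show n + 1 + 1 = n + 2 by omega, mul_one_div] at h4
      linarith)
    (fun n h1 h2 => by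
      have hn0 : (A : ℝ) ≤ n := by exact_mod_cast h1
      have e1 : 0 ≤ τ * Real.log (1 + 1 / (n : ℝ)) :=
        mul_nonneg hτ.le (Real.log_nonneg (by simp))
      have e2 : τ * Real.log (1 + 1 / (A : ℝ)) ≤ τ * (1 / A) := by
        gcongr
        refine (Real.log_le_sub_one_of_pos (by positivity)).trans_eq (by ring)
      rw [← hlog n h1] at e1
      rw [← hlog A le_rfl, mul_one_div] at e2
      linarith)
  refine h.trans_eq ?_
  rw [Real.sqrt_div hτ.le, show (4 * (A : ℝ) ^ 2) = (2 * A) ^ 2 by ring,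
    Real.sqrt_sq (by positivity)]
  have := Real.sqrt_pos.2 hτ
  congr 2
  field_simp
  norm_num

/-- The second derivative test for a differenced logarithmic phase. -/
lemma norm_sum_ee_log_sub_log_le {τ : ℝ} (hτ : 0 < τ) {A M q r : ℕ} (hA : 1 ≤ A) (hM : M ≤ A)
    (hq : 1 ≤ q) (hqr : q + r ≤ A) :
    ‖∑ n ∈ Finset.range M, ee (τ * Real.log ((A + (n + (q + r)) : ℕ) : ℝ)
        - τ * Real.log ((A + (n + r) : ℕ) : ℝ))‖
      ≤ (τ * q / A ^ 2 + 2) * (3 / √(τ * q / (54 * A ^ 3)) + 2) := by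
  have hA0 : (0 : ℝ) < A := by exact_mod_cast hA
  have hq0 : (0 : ℝ) < q := by exact_mod_cast hq
  set f : ℕ → ℝ := fun n => τ * Real.log ((A + (n + (q + r)) : ℕ) : ℝ)
        - τ * Real.log ((A + (n + r) : ℕ) : ℝ) with hf
  set Y : ℝ → ℝ := fun m => 1 + q / (m * (m + 1 + q)) with hY
  have hd : ∀ n, f (n + 1) - f n = -(τ * Real.log (Y ((A + (n + r) : ℕ) : ℝ))) := by
    intro n
    have hm : (0 : ℝ) < ((A + (n + r) : ℕ) : ℝ) := by
      have : 0 < A + (n + r) := by omega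
      exact_mod_cast this
    simp only [hf]
    have c1 : ((A + (n + (q + r)) : ℕ) : ℝ) = ((A + (n + r) : ℕ) : ℝ) + q := by push_cast; ring
    have c2 : ((A + (n + 1 + (q + r)) : ℕ) : ℝ) = ((A + (n + r) : ℕ) : ℝ) + 1 + q := by
      push_cast; ring
    have c3 : ((A + (n + 1 + r) : ℕ) : ℝ) = ((A + (n + r) : ℕ) : ℝ) + 1 := by push_cast; ring
    rw [c1, c2, c3]
    generalize ((A + (n + r) : ℕ) : ℝ) = m at *
    have : Y m = (m + q) * (m + 1) / (m * (m + 1 + q)) := by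
      simp only [hY]; field_simp; ring
    rw [this, Real.log_div (by positivity) (by positivity), Real.log_mul (by positivity)
      (by positivity), Real.log_mul (by positivity) (by positivity)]
    ring
  rw [Finset.range_eq_Ico]
  refine norm_sum_ee_le (f := f) (by positivity) (by positivity) (fun n _ h2 => ?_)
    (fun n _ h2 => ?_)
  · rw [show n + 2 = n + 1 + 1 by omega, hd (n + 1), hd n]
    have c3 : ((A + (n + 1 + r) : ℕ) : ℝ) = ((A + (n + r) : ℕ) : ℝ) + 1 := by push_cast; ring
    have hm1 : (A : ℝ) ≤ ((A + (n + r) : ℕ) : ℝ) := by exact_mod_cast Nat.le_add_right _ _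
    have hm2 : ((A + (n + r) : ℕ) : ℝ) + 2 + q ≤ 3 * A := by
      have : A + (n + r) + 2 + q ≤ 3 * A := by omega
      exact_mod_cast this
    rw [c3]
    generalize ((A + (n + r) : ℕ) : ℝ) = m at *
    have hm0 : 0 < m := by linarith
    have hqm : (q : ℝ) ≤ m := le_trans (by exact_mod_cast (by omega : q ≤ A)) hm1
    have hY1 : 0 < Y m := by simp only [hY]; positivity
    have hY2 : 0 < Y (m + 1) := by simp only [hY]; positivity
    have key : q / (54 * (A : ℝ) ^ 3) ≤ Real.log (Y m) - Real.log (Y (m + 1)) := by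
      rw [← Real.log_div hY1.ne' hY2.ne']
      refine le_trans ?_ (Real.one_sub_inv_le_log_of_pos (by positivity))
      have e1 : 1 - (Y m / Y (m + 1))⁻¹
          = q * (2 * m + 2 + q) / ((m + 1) * (m + 2 + q) * ((m + q) * (m + 1))) := by
        have : Y m = (m + q) * (m + 1) / (m * (m + 1 + q)) := by
          simp only [hY]; field_simp; ring
        rw [this]
        have : Y (m + 1) = (m + 1 + q) * (m + 2) / ((m + 1) * (m + 2 + q)) := by
          simp only [hY]; field_simp; ring
        rw [this]
        field_simp
        ring
      rw [e1]
      calc q / (54 * (A : ℝ) ^ 3) ≤ q * (2 * m + 2 + q) / ((3 * A) * (3 * A) * ((2 * m + 2 + q) * (3 * A))) := by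
            rw [div_le_div_iff₀ (by positivity) (by positivity)]
            have : 0 ≤ q * (2 * m + 2 + q) * (A : ℝ) ^ 3 := by positivity
            nlinarith
        _ ≤ _ := by
            gcongr
            · linarith
            · linarith
            · linarith
    have := mul_le_mul_of_nonneg_left key hτ.le
    rw [← mul_div_assoc] at this
    linarith
  · rw [hd n, hd 0]
    have hm1 : (A : ℝ) ≤ ((A + (n + r) : ℕ) : ℝ) := by exact_mod_cast Nat.le_add_right _ _
    have hm2 : (A : ℝ) ≤ ((A + (0 + r) : ℕ) : ℝ) := by exact_mod_cast Nat.le_add_right _ _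
    generalize ((A + (n + r) : ℕ) : ℝ) = m at *
    generalize ((A + (0 + r) : ℕ) : ℝ) = m' at *
    have hm0 : 0 < m := by linarith
    have hm0' : 0 < m' := by linarith
    have e1 : 0 ≤ Real.log (Y m) := Real.log_nonneg (by
      simp only [hY]; have : 0 ≤ q / (m * (m + 1 + q)) := by positivity
      linarith)
    have e2 : Real.log (Y m') ≤ q / (A : ℝ) ^ 2 := by
      refine (Real.log_le_sub_one_of_pos (by simp only [hY]; positivity)).trans ?_
      simp only [hY, add_sub_cancel_left]
      gcongr
      nlinarith
    have := mul_le_mul_of_nonneg_left e2 hτ.le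
    rw [← mul_div_assoc] at this
    nlinarith [mul_nonneg hτ.le e1]

lemma sum_inv_sqrt_le (H : ℕ) : ∑ q ∈ Finset.Ico 1 H, 1 / √(q : ℝ) ≤ 2 * √(H : ℝ) := by
  have key : ∀ H : ℕ, ∑ q ∈ Finset.Ico 1 (H + 1), 1 / √(q : ℝ) ≤ 2 * √(H : ℝ) := by
    intro H
    induction H with
    | zero => simp
    | succ H ih =>
      rw [Finset.sum_Ico_succ_top (by omega)]
      have hb : 0 < √((H + 1 : ℕ) : ℝ) := Real.sqrt_pos.2 (by positivity)
      have ha2 : √(H : ℝ) ^ 2 = H := Real.sq_sqrt (by positivity)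
      have hb2 : √((H + 1 : ℕ) : ℝ) ^ 2 = H + 1 := by
        rw [Real.sq_sqrt (by positivity)]; push_cast; ring
      have : 1 / √((H + 1 : ℕ) : ℝ) ≤ 2 * (√((H + 1 : ℕ) : ℝ) - √(H : ℝ)) := by
        rw [div_le_iff₀ hb]
        nlinarith [sq_nonneg (√((H + 1 : ℕ) : ℝ) - √(H : ℝ))]
      linarith
  refine le_trans ?_ (key H)
  exact Finset.sum_le_sum_of_subset_of_nonneg (Finset.Ico_subset_Ico_right (by omega))
    fun q _ _ => by positivity

/-- Van der Corput's third derivative estimate for `n ^ (-2πiτ)`, `τ = T ^ 6`. -/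
lemma norm_sum_ee_log_le_third {T : ℝ} (hT : 1 ≤ T) {A M : ℕ} (hA : T ^ 2 ≤ A) (hA' : A ≤ T ^ 4)
    (hM : M ≤ A) :
    ‖∑ n ∈ Finset.Ico A (A + M), ee (-(T ^ 6 * Real.log n))‖ ≤ 25 * (√A * T) := by
  have hT0 : 0 < T := by linarith
  have hA0 : (0 : ℝ) < A := lt_of_lt_of_le (by positivity) hA
  have hA1 : 1 ≤ A := by exact_mod_cast hA0
  set H : ℕ := ⌊(A : ℝ) / T ^ 2⌋₊ with hH
  have hH1 : 1 ≤ H := by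
    rw [hH, Nat.one_le_floor_iff, le_div_iff₀ (by positivity)]; linarith
  have hHle : (H : ℝ) ≤ A / T ^ 2 := Nat.floor_le (by positivity)
  have hHge : (A : ℝ) / T ^ 2 ≤ 2 * H := by
    have := Nat.lt_floor_add_one ((A : ℝ) / T ^ 2)
    have h1 : (1 : ℝ) ≤ H := by exact_mod_cast hH1
    linarith
  have hHA : H ≤ A := by
    have : (H : ℝ) ≤ A := hHle.trans (div_le_self hA0.le (one_le_pow₀ hT))
    exact_mod_cast this
  set a := √(A : ℝ) with ha
  set h := √(H : ℝ) with hh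
  have ha0 : 0 < a := Real.sqrt_pos.2 hA0
  have hh1 : 1 ≤ h := Real.one_le_sqrt.2 (by exact_mod_cast hH1)
  have ha2 : a ^ 2 = A := Real.sq_sqrt hA0.le
  have hh2 : h ^ 2 = H := Real.sq_sqrt (Nat.cast_nonneg _)
  have hhT : h * T ≤ a := by
    refine le_of_sq_le ha0.le ?_
    rw [mul_pow, ha2, hh2]; rwa [le_div_iff₀ (by positivity)] at hHle
  have haT : a ≤ T ^ 2 := by
    refine le_of_sq_le (by positivity) ?_
    linarith [show (T ^ 2) ^ 2 = T ^ 4 by ring]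
  have hTa : T ≤ a := by
    refine le_of_sq_le (by positivity) ?_
    linarith
  have hah : a ≤ 3 / 2 * (h * T) := by
    refine le_of_sq_le (by positivity) ?_
    rw [mul_pow, mul_pow, ha2, hh2]; rw [div_le_iff₀ (by positivity)] at hHge
    have : (0 : ℝ) ≤ H * T ^ 2 := by positivity
    linarith
  set B : ℕ → ℝ := fun q => 23 * T ^ 3 / a * h + 2 * T ^ 6 / a ^ 4 * h ^ 2
    + 46 * a ^ 3 / T ^ 3 * (1 / √(q : ℝ)) + 4 with hB
  have hvdc := van_der_corput (z := fun n => ee (T ^ 6 * Real.log ((A + n : ℕ) : ℝ)))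
    (fun n => (norm_ee _).le) (N := M) (H := H) (B := B) (by
      intro q r hq hqr
      have h1 := norm_sum_ee_log_sub_log_le (τ := T ^ 6) (by positivity) hA1 hM hq
        (by omega : q + r ≤ A)
      simp_rw [conj_ee, ← ee_add, ← sub_eq_add_neg]
      refine h1.trans ?_
      have hq0 : (0 : ℝ) < q := by exact_mod_cast hq
      set p := √(q : ℝ) with hp
      have hp0 : 0 < p := Real.sqrt_pos.2 hq0
      have hp2 : p ^ 2 = q := Real.sq_sqrt hq0.le
      have hph : p ≤ h := Real.sqrt_le_sqrt (by exact_mod_cast (by omega : q ≤ H))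
      have e1 : 3 / √(T ^ 6 * q / (54 * (A : ℝ) ^ 3)) ≤ 23 * (a ^ 3 / (T ^ 3 * p)) := by
        rw [← hp2, ← ha2, div_le_iff₀ (Real.sqrt_pos.2 (by positivity)),
          ← div_le_iff₀' (by positivity)]
        apply Real.le_sqrt_of_sq_le
        rw [div_pow, le_div_iff₀ (by positivity), div_mul_eq_mul_div, div_le_iff₀ (by positivity)]
        have : T ^ 6 * p ^ 2 * (23 * (a ^ 3 / (T ^ 3 * p))) ^ 2 = 529 * a ^ 6 := by
          field_simp; norm_num
        rw [this]
        nlinarith [pow_pos ha0 6]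
      calc _ ≤ (T ^ 6 * p ^ 2 / (a ^ 2) ^ 2 + 2) * (23 * (a ^ 3 / (T ^ 3 * p)) + 2) := by
            rw [← hp2, ← ha2] at *; gcongr
        _ = 23 * T ^ 3 / a * p + 2 * T ^ 6 / a ^ 4 * p ^ 2 + 46 * a ^ 3 / T ^ 3 * (1 / p) + 4 := by
            field_simp; ring
        _ ≤ _ := by simp only [hB]; gcongr)
  have hBsum : ∑ q ∈ Finset.Ico 1 H, B q ≤ 121 * a ^ 2 := by
    have e0 : ∑ q ∈ Finset.Ico 1 H, B q = ((H - 1 : ℕ) : ℝ) *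
        (23 * T ^ 3 / a * h + 2 * T ^ 6 / a ^ 4 * h ^ 2 + 4)
        + 46 * a ^ 3 / T ^ 3 * ∑ q ∈ Finset.Ico 1 H, 1 / √(q : ℝ) := by
      rw [Finset.mul_sum, ← nsmul_eq_mul, ← Nat.card_Ico, ← Finset.sum_const,
        ← Finset.sum_add_distrib]
      refine Finset.sum_congr rfl fun q _ => ?_
      simp only [hB]; ring
    have e1 : ((H - 1 : ℕ) : ℝ) ≤ h ^ 2 := by rw [hh2]; exact_mod_cast Nat.sub_le H 1
    rw [e0]
    calc _ ≤ h ^ 2 * (23 * T ^ 3 / a * h + 2 * T ^ 6 / a ^ 4 * h ^ 2 + 4)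
          + 46 * a ^ 3 / T ^ 3 * (2 * h) := by gcongr; exact sum_inv_sqrt_le H
      _ = 23 * (h * T) ^ 3 / a + 2 * (h * T) ^ 4 * T ^ 2 / a ^ 4 + 4 * h ^ 2
          + 92 * a ^ 3 * (h * T) / T ^ 4 := by field_simp; ring
      _ ≤ 23 * a ^ 3 / a + 2 * a ^ 4 * a ^ 2 / a ^ 4 + 4 * a ^ 2 + 92 * a ^ 3 * a / a ^ 2 := by
          have : h ≤ a := le_trans (le_mul_of_one_le_right (by linarith) hT) hhT
          have h4 : a ^ 2 ≤ T ^ 4 := by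
            calc a ^ 2 ≤ (T ^ 2) ^ 2 := by gcongr
              _ = _ := by ring
          gcongr
      _ = 121 * a ^ 2 := by field_simp; norm_num
  have hMa : (M : ℝ) ≤ a ^ 2 := by rw [ha2]; exact_mod_cast hM
  have hsq : √(M * H * (M + 2 * ∑ q ∈ Finset.Ico 1 H, B q)) ≤ 16 * a ^ 2 * h := by
    apply Real.sqrt_le_iff.2 ⟨by positivity, ?_⟩
    rw [← hh2]
    have hBs : 0 ≤ ∑ q ∈ Finset.Ico 1 H, B q := Finset.sum_nonneg fun q _ => by
      simp only [hB]; positivity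
    calc _ ≤ a ^ 2 * h ^ 2 * (a ^ 2 + 2 * (121 * a ^ 2)) := by gcongr
      _ ≤ _ := by have : 0 ≤ a ^ 4 * h ^ 2 := by positivity
                  nlinarith
  have hS : ‖∑ n ∈ Finset.Ico A (A + M), ee (-(T ^ 6 * Real.log n))‖
      = ‖∑ n ∈ Finset.range M, ee (T ^ 6 * Real.log ((A + n : ℕ) : ℝ))‖ := by
    rw [norm_sum_ee_neg, Finset.sum_Ico_eq_sum_range, Nat.add_sub_cancel_left]
  rw [hS]
  set S := ‖∑ n ∈ Finset.range M, ee (T ^ 6 * Real.log ((A + n : ℕ) : ℝ))‖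
  rw [← hh2] at hvdc hsq
  have h0 : 0 < h := by linarith
  have h1 : h ^ 2 * S ≤ h ^ 2 * (25 * (a * T)) := by
    calc h ^ 2 * S ≤ (h ^ 2) ^ 2 + 16 * a ^ 2 * h := hvdc.trans (by gcongr)
      _ ≤ h ^ 2 * (a * T) + 16 * a * (3 / 2 * (h * T)) * h := by
          have : h ^ 2 ≤ a * T := by
            have : h ≤ a := le_trans (le_mul_of_one_le_right (by linarith) hT) hhT
            nlinarith
          have h5 : a * a * h ≤ a * (3 / 2 * (h * T)) * h := by gcongr
          nlinarith [mul_le_mul_of_nonneg_left this (sq_nonneg h)]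
      _ = _ := by ring
  exact le_of_mul_le_mul_left h1 (by positivity)

lemma norm_sum_ee_log_le {T : ℝ} (hT : 2 ≤ T) {A M : ℕ} (hA : 1 ≤ A) (hA' : A ≤ T ^ 14)
    (hM : M ≤ A) :
    ‖∑ n ∈ Finset.Ico A (A + M), ee (-(T ^ 6 * Real.log n))‖ ≤ 30 * (√A * T) := by
  have hT0 : 0 < T := by linarith
  have hA0 : (0 : ℝ) < A := by exact_mod_cast hA
  set a := √(A : ℝ) with ha
  have ha0 : 0 < a := Real.sqrt_pos.2 hA0
  have ha1 : 1 ≤ a := Real.one_le_sqrt.2 (by exact_mod_cast hA)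
  have ha2 : a ^ 2 = A := Real.sq_sqrt hA0.le
  rcases le_total (A : ℝ) (T ^ 2) with h1 | h1
  · have haT : a ≤ T := by
      refine le_of_sq_le hT0.le ?_
      linarith
    refine (norm_sum_le_of_le _ fun n _ => (norm_ee _).le).trans ?_
    simp only [Finset.sum_const, Nat.card_Ico, nsmul_eq_mul, mul_one, Nat.add_sub_cancel_left]
    have : (M : ℝ) ≤ a ^ 2 := by rw [ha2]; exact_mod_cast hM
    nlinarith
  rcases le_total (A : ℝ) (T ^ 4) with h2 | h2
  · exact (norm_sum_ee_log_le_third (by linarith) h1 h2 hM).trans (by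
      have : 0 < a * T := by positivity
      linarith)
  have haT2 : T ^ 2 ≤ a := by
    refine le_of_sq_le ha0.le ?_
    linarith [show (T ^ 2) ^ 2 = T ^ 4 by ring]
  rcases le_total (A : ℝ) (T ^ 8) with h3 | h3
  · have haT4 : a ≤ T ^ 4 := by
      refine le_of_sq_le (by positivity) ?_
      linarith [show (T ^ 4) ^ 2 = T ^ 8 by ring]
    refine (norm_sum_ee_log_le_second (τ := T ^ 6) (by positivity) hA hM).trans ?_
    rw [show T ^ 6 = (T ^ 3) ^ 2 by ring, Real.sqrt_sq (by positivity), ← ha2]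
    calc _ = 6 * T ^ 3 + 2 * T ^ 2 * T ^ 4 / a ^ 2 + 12 * a * a / T ^ 3 + 4 := by
          field_simp; ring
      _ ≤ 6 * (a * T) + 2 * T ^ 2 * a ^ 2 / a ^ 2 + 12 * a * T ^ 4 / T ^ 3 + 4 * (a * T) := by
          have : T ^ 3 ≤ a * T := by nlinarith
          have h4 : T ^ 4 ≤ a ^ 2 := by
            calc T ^ 4 = (T ^ 2) ^ 2 := by ring
              _ ≤ _ := by gcongr
          gcongr
          nlinarith
      _ = 6 * (a * T) + 2 * T ^ 2 + 12 * (a * T) + 4 * (a * T) := by field_simp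
      _ ≤ _ := by nlinarith
  · refine (norm_sum_ee_log_le_div (τ := T ^ 6) (by positivity) (by nlinarith [pow_pos hT0 6, pow_pos hT0 7]) hM).trans ?_
    have haT7 : a ≤ T ^ 7 := by
      refine le_of_sq_le (by positivity) ?_
      linarith [show (T ^ 7) ^ 2 = T ^ 14 by ring]
    rw [← ha2]
    calc 2 * a ^ 2 / T ^ 6 = 2 * a * a / T ^ 6 := by ring
      _ ≤ 2 * a * T ^ 7 / T ^ 6 := by gcongr
      _ = 2 * (a * T) := by field_simp
      _ ≤ _ := by have : 0 < a * T := by positivity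
                  linarith

/-- Abel summation against nonnegative antitone weights. -/
lemma norm_sum_antitone_mul_le {w : ℕ → ℝ} {z : ℕ → ℂ} {K : ℝ} {M : ℕ}
    (hw : ∀ n, n + 1 < M → w (n + 1) ≤ w n) (hw0 : ∀ n, 0 ≤ w n)
    (hK : ∀ m ≤ M, ‖∑ n ∈ Finset.range m, z n‖ ≤ K) :
    ‖∑ n ∈ Finset.range M, (w n : ℂ) * z n‖ ≤ w 0 * K := by
  rcases M with _ | M
  · simpa using mul_nonneg (hw0 0) ((norm_nonneg _).trans (hK 0 le_rfl))
  have key : ∀ m ≤ M, ‖∑ n ∈ Finset.range (m + 1), (w n : ℂ) * z n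
      - w m * ∑ n ∈ Finset.range (m + 1), z n‖ ≤ (w 0 - w m) * K := by
    intro m
    induction m with
    | zero => intro _; simp
    | succ m ih =>
      intro hm
      have e : ∑ n ∈ Finset.range (m + 1 + 1), (w n : ℂ) * z n
          - w (m + 1) * ∑ n ∈ Finset.range (m + 1 + 1), z n
          = (∑ n ∈ Finset.range (m + 1), (w n : ℂ) * z n
            - w m * ∑ n ∈ Finset.range (m + 1), z n)
            + ((w m - w (m + 1) : ℝ) : ℂ) * ∑ n ∈ Finset.range (m + 1), z n := by
        rw [Finset.sum_range_succ _ (m + 1), Finset.sum_range_succ z (m + 1)]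
        push_cast; ring
      rw [e]
      refine (norm_add_le _ _).trans ?_
      rw [norm_mul, norm_real, Real.norm_of_nonneg (sub_nonneg.2 (hw m (by omega)))]
      have h1 := ih (by omega)
      have h2 := mul_le_mul_of_nonneg_left (hK (m + 1) (by omega))
        (sub_nonneg.2 (hw m (by omega)))
      linarith
  have h1 := key M le_rfl
  have h2 : ‖(w M : ℂ) * ∑ n ∈ Finset.range (M + 1), z n‖ ≤ w M * K := by
    rw [norm_mul, norm_real, Real.norm_of_nonneg (hw0 M)]
    exact mul_le_mul_of_nonneg_left (hK (M + 1) le_rfl) (hw0 M)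
  calc _ = ‖(∑ n ∈ Finset.range (M + 1), (w n : ℂ) * z n
      - w M * ∑ n ∈ Finset.range (M + 1), z n) + w M * ∑ n ∈ Finset.range (M + 1), z n‖ := by
        rw [sub_add_cancel]
    _ ≤ _ := (norm_add_le _ _).trans (by linarith)

lemma natCast_cpow_neg_eq {T : ℝ} {n : ℕ} (hn : 0 < n) :
    (n : ℂ) ^ (-(1 / 2 + I * ((2 * Real.pi * T ^ 6 : ℝ) : ℂ)))
      = ((1 / √(n : ℝ) : ℝ) : ℂ) * ee (-(T ^ 6 * Real.log n)) := by
  have hn0 : (n : ℂ) ≠ 0 := by exact_mod_cast hn.ne'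
  have h1 : ((1 / √(n : ℝ) : ℝ) : ℂ) = (n : ℂ) ^ (-(1 / 2 : ℂ)) := by
    rw [Real.sqrt_eq_rpow, one_div, ← Real.rpow_neg (Nat.cast_nonneg _),
      ofReal_cpow (Nat.cast_nonneg _)]
    push_cast; rfl
  rw [h1, neg_add, cpow_add _ _ hn0]
  congr 1
  rw [cpow_def_of_ne_zero hn0, ee, ← natCast_log]
  congr 1
  push_cast
  ring

lemma norm_sum_dyadic_le {T : ℝ} (hT : 2 ≤ T) {A : ℕ} (hA : 1 ≤ A) (hA' : A ≤ T ^ 14) :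
    ‖∑ n ∈ Finset.Ico A (A + A), ((n : ℕ) : ℂ) ^ (-(1 / 2 + I * ((2 * Real.pi * T ^ 6 : ℝ) : ℂ)))‖
      ≤ 30 * T := by
  have hA0 : (0 : ℝ) < A := by exact_mod_cast hA
  have h := norm_sum_antitone_mul_le (w := fun n : ℕ => 1 / √((A + n : ℕ) : ℝ))
    (z := fun n => ee (-(T ^ 6 * Real.log ((A + n : ℕ) : ℝ)))) (K := 30 * (√A * T)) (M := A)
    (fun n _ => by
      have : 0 < √((A + n : ℕ) : ℝ) := Real.sqrt_pos.2 (by positivity)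
      gcongr
      omega)
    (fun n => by positivity)
    (fun m hm => by
      have := norm_sum_ee_log_le hT hA hA' hm
      rwa [Finset.sum_Ico_eq_sum_range, Nat.add_sub_cancel_left] at this)
  rw [Finset.sum_Ico_eq_sum_range, Nat.add_sub_cancel_left]
  have e : ∀ n : ℕ, ((A + n : ℕ) : ℂ) ^ (-(1 / 2 + I * ((2 * Real.pi * T ^ 6 : ℝ) : ℂ)))
      = ((1 / √((A + n : ℕ) : ℝ) : ℝ) : ℂ) * ee (-(T ^ 6 * Real.log ((A + n : ℕ) : ℝ))) :=
    fun n => natCast_cpow_neg_eq (by omega)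
  simp_rw [e]
  refine h.trans_eq ?_
  have := Real.sqrt_pos.2 hA0
  rw [add_zero]
  field_simp

lemma norm_sum_two_pow_le {T : ℝ} (hT : 2 ≤ T) {J : ℕ} (hJ : (2 : ℝ) ^ J ≤ 2 * T ^ 14) :
    ‖∑ n ∈ Finset.Ico (1 : ℕ) (2 ^ J), (n : ℂ) ^ (-(1 / 2 + I * ((2 * Real.pi * T ^ 6 : ℝ) : ℂ)))‖
      ≤ J * (30 * T) := by
  induction J with
  | zero => simp
  | succ J ih =>
    have h1 : (2 : ℝ) ^ J ≤ T ^ 14 := by rw [pow_succ] at hJ; linarith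
    rw [← Finset.sum_Ico_consecutive _ (Nat.one_le_two_pow (n := J))
      (Nat.pow_le_pow_right two_pos J.le_succ)]
    have h2 := norm_sum_dyadic_le hT (A := 2 ^ J) Nat.one_le_two_pow (by exact_mod_cast h1)
    rw [← two_mul, ← pow_succ'] at h2
    have h3 := ih (by linarith [show (0 : ℝ) ≤ T ^ 14 by positivity])
    exact (norm_add_le _ _).trans ((add_le_add h3 h2).trans_eq (by push_cast; ring))

lemma norm_riemannZeta_half_le {T : ℝ} (hT : 2 ≤ T) :
    ‖riemannZeta (1 / 2 + I * ((2 * Real.pi * T ^ 6 : ℝ) : ℂ))‖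
      ≤ 55 * T + 720 * (T * Real.log T) := by
  have hT0 : 0 < T := by linarith
  have hpi := Real.pi_gt_three
  have hpi' := Real.pi_lt_four
  set t : ℝ := 2 * Real.pi * T ^ 6 with ht
  set s : ℂ := 1 / 2 + I * (t : ℂ) with hs
  have hre : s.re = 1 / 2 := by simp [hs]
  have him : s.im = t := by simp [hs]
  have ht0 : 0 < t := by positivity
  have ht1 : T ^ 6 ≤ t := by nlinarith [pow_pos hT0 6]
  have hs1 : s ≠ 1 := fun h => by rw [h] at hre; norm_num at hre
  obtain ⟨n, hn1, hn2⟩ := exists_nat_pow_near (one_le_pow₀ (by linarith : 1 ≤ T) : 1 ≤ T ^ 12)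
    (one_lt_two : (1 : ℝ) < 2)
  set J := n + 1 with hJ
  have hJ2 : (2 : ℝ) ^ J ≤ 2 * T ^ 12 := by rw [hJ, pow_succ]; linarith
  have hJlog : (J : ℝ) ≤ 1 + 24 * Real.log T := by
    have := Real.log_le_log (by positivity) hn1
    rw [Real.log_pow, Real.log_pow] at this
    have h2 := Real.log_two_gt_d9
    have h3 : (0 : ℝ) ≤ n := Nat.cast_nonneg _
    rw [hJ]; push_cast at this ⊢
    nlinarith
  have hz := norm_riemannZeta_sub_sum_le (by rw [hre]) hs1 (2 ^ J - 1)
  have hcast : ((2 ^ J - 1 : ℕ) : ℝ) + 1 = 2 ^ J := by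
    rw [Nat.cast_sub Nat.one_le_two_pow]; push_cast; ring
  have hsum : ∑ n ∈ Finset.range (2 ^ J - 1), ((n + 1 : ℕ) : ℂ) ^ (-s)
      = ∑ n ∈ Finset.Ico (1 : ℕ) (2 ^ J), (n : ℂ) ^ (-s) := by
    rw [Finset.sum_Ico_eq_sum_range]
    exact Finset.sum_congr rfl fun n _ => by rw [add_comm]
  rw [hcast, hsum, Nat.sub_add_cancel Nat.one_le_two_pow] at hz
  have hT12 : T ^ 12 = (T ^ 6) ^ 2 := by ring
  have e1 : 3 * ‖s‖ * ((2 : ℝ) ^ J) ^ (-(1 / 2) : ℝ) ≤ 27 := by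
    have hns : ‖s‖ ≤ 9 * T ^ 6 := by
      refine (norm_add_le _ _).trans ?_
      rw [norm_mul, norm_I, norm_real, Real.norm_of_nonneg ht0.le]
      have : (1 : ℝ) ≤ T ^ 6 := one_le_pow₀ (by linarith)
      norm_num
      nlinarith
    have hp : ((2 : ℝ) ^ J) ^ (-(1 / 2) : ℝ) ≤ 1 / T ^ 6 := by
      rw [Real.rpow_neg (by positivity), ← Real.sqrt_eq_rpow, ← one_div]
      apply one_div_le_one_div_of_le (by positivity)
      apply Real.le_sqrt_of_sq_le
      rw [← hT12]; exact hn2.le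
    calc _ ≤ 3 * (9 * T ^ 6) * (1 / T ^ 6) := by gcongr
      _ = 27 := by field_simp; norm_num
  have e2 : ‖((2 ^ J : ℕ) : ℂ) ^ (1 - s) / (s - 1)‖ ≤ 1 := by
    have h1 : ‖((2 ^ J : ℕ) : ℂ) ^ (1 - s)‖ ≤ 2 * T ^ 6 := by
      rw [norm_natCast_cpow_of_pos (by positivity), sub_re, one_re, hre,
        show (1 : ℝ) - 1 / 2 = 1 / 2 by norm_num, ← Real.sqrt_eq_rpow]
      apply Real.sqrt_le_iff.2 ⟨by positivity, ?_⟩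
      push_cast
      nlinarith [pow_pos hT0 12]
    have h2 : 2 * T ^ 6 ≤ ‖s - 1‖ := by
      refine le_trans ?_ (abs_im_le_norm (s - 1))
      rw [sub_im, one_im, him, sub_zero, abs_of_pos ht0]
      nlinarith [pow_pos hT0 6]
    rw [norm_div]
    exact div_le_one_of_le₀ (h1.trans h2) (norm_nonneg _)
  have e3 := norm_sum_two_pow_le hT (J := J) (hJ2.trans (by
    gcongr
    · linarith
    · norm_num))
  have e4 : (J : ℝ) * (30 * T) ≤ (1 + 24 * Real.log T) * (30 * T) := by gcongr
  generalize ∑ n ∈ Finset.Ico (1 : ℕ) (2 ^ J), (n : ℂ) ^ (-s) = D at *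
  generalize ((2 ^ J : ℕ) : ℂ) ^ (1 - s) / (s - 1) = E at *
  calc ‖riemannZeta s‖ = ‖(riemannZeta s - D - E) + D + E‖ := by congr 1; ring
    _ ≤ 27 + J * (30 * T) + 1 := (norm_add₃_le).trans (by gcongr; exact hz.trans e1)
    _ ≤ _ := by nlinarith

/-- The Weyl-Hardy-Littlewood bound for `ζ` on the critical line. -/
lemma isBigO_riemannZeta_half {δ : ℝ} (hδ : 0 < δ) :
    (fun t : ℝ => riemannZeta (1 / 2 + I * t)) =O[atTop] fun t : ℝ => t ^ (1 / 6 + δ) := by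
  refine IsBigO.of_bound (55 + 120 / δ) ?_
  have hpi := Real.pi_gt_three
  filter_upwards [eventually_ge_atTop (2 * Real.pi * 2 ^ 6)] with t ht
  have ht0 : 0 < t := lt_of_lt_of_le (by positivity) ht
  set τ := t / (2 * Real.pi) with hτ
  have hτ0 : 0 < τ := by positivity
  have hτ2 : 2 ^ 6 ≤ τ := by rw [hτ, le_div_iff₀ (by positivity)]; linarith
  have hτt : τ ≤ t := div_le_self ht0.le (by linarith)
  set T := τ ^ (1 / 6 : ℝ) with hT
  have hT6 : T ^ 6 = τ := by
    rw [hT, ← Real.rpow_natCast, ← Real.rpow_mul hτ0.le]; norm_num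
  have hT2 : 2 ≤ T := by
    have h0 : 0 ≤ T := by positivity
    by_contra! h
    have : T ^ 6 < 2 ^ 6 := by gcongr
    linarith
  have h := norm_riemannZeta_half_le hT2
  rw [hT6, show 2 * Real.pi * τ = t by rw [hτ]; field_simp] at h
  refine h.trans ?_
  have hTt : T ≤ t ^ (1 / 6 : ℝ) := Real.rpow_le_rpow hτ0.le hτt (by norm_num)
  have hTδ : Real.log T ≤ t ^ δ / (6 * δ) := by
    rw [hT, Real.log_rpow hτ0]
    have h1 := Real.log_le_rpow_div hτ0.le hδ
    have h2 : τ ^ δ ≤ t ^ δ := Real.rpow_le_rpow hτ0.le hτt hδ.le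
    calc 1 / 6 * Real.log τ ≤ 1 / 6 * (t ^ δ / δ) := by gcongr; exact h1.trans (by gcongr)
      _ = _ := by field_simp
  have h1 : 1 ≤ t ^ δ := Real.one_le_rpow (by nlinarith) hδ.le
  have hlog0 : 0 ≤ Real.log T := Real.log_nonneg (by linarith)
  rw [Real.norm_of_nonneg (by positivity), Real.rpow_add ht0]
  calc 55 * T + 720 * (T * Real.log T)
      ≤ 55 * (t ^ (1 / 6 : ℝ) * t ^ δ) + 720 * (t ^ (1 / 6 : ℝ) * (t ^ δ / (6 * δ))) := by
        gcongr
        exact hTt.trans (le_mul_of_one_le_right (by positivity) h1)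
    _ = _ := by field_simp; ring

/-- The difference `log (z + n + 1) - log (z + n) - 1 / (z + n)`. -/
noncomputable def digammaTerm (n : ℕ) (z : ℂ) : ℂ := log (z + n + 1) - log (z + n) - (z + n)⁻¹

lemma norm_le_norm_add_of_re_nonneg {w : ℂ} (hw : 0 ≤ w.re) {s : ℝ} (hs : 0 ≤ s) :
    ‖w‖ ≤ ‖w + s‖ := by
  rw [← sq_le_sq₀ (norm_nonneg _) (norm_nonneg _), ← normSq_eq_norm_sq, ← normSq_eq_norm_sq,
    normSq_apply, normSq_apply]
  simp only [add_re, ofReal_re, add_im, ofReal_im, add_zero]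
  nlinarith [mul_nonneg hw hs]

lemma norm_log_add_one_sub_log_sub_inv_le {w : ℂ} (hw : 0 < w.re) :
    ‖log (w + 1) - log w - w⁻¹‖ ≤ 1 / ‖w‖ ^ 2 := by
  have hw0 : w ≠ 0 := fun h => by simp [h] at hw
  have h := Convex.norm_image_sub_le_of_norm_hasDerivWithin_le
    (f := fun s : ℝ => log (w + s) - s * w⁻¹) (f' := fun s : ℝ => (w + s)⁻¹ - w⁻¹)
    (s := Set.Icc 0 1) (x := 0) (y := 1) (C := 1 / ‖w‖ ^ 2)
    (fun s hs => by
      have hm : w + s ∈ slitPlane := Or.inl (by simp; linarith [hs.1])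
      have e1 : HasDerivAt (fun s : ℝ => w + (s : ℂ)) 1 s :=
        (Complex.ofRealCLM.hasDerivAt (x := s)).const_add w
      have e2 := (e1.clog_real hm).sub ((Complex.ofRealCLM.hasDerivAt (x := s)).mul_const w⁻¹)
      refine HasDerivAt.hasDerivWithinAt (e2.congr_deriv ?_)
      simp)
    (fun s hs => by
      have hm : w + s ≠ 0 := fun h => by
        have := congrArg Complex.re h
        simp at this
        linarith [hs.1]
      have hn := norm_le_norm_add_of_re_nonneg hw.le hs.1
      have hwn : 0 < ‖w‖ := norm_pos_iff.2 hw0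
      rw [inv_sub_inv hm hw0, norm_div, norm_mul, sub_add_cancel_left, norm_neg, norm_real,
        Real.norm_of_nonneg hs.1]
      rw [sq]
      gcongr
      exact hs.2)
    (convex_Icc 0 1) ⟨le_rfl, zero_le_one⟩ ⟨zero_le_one, le_rfl⟩
  have e : log (w + (1 : ℝ)) - ((1 : ℝ) : ℂ) * w⁻¹ - (log (w + (0 : ℝ)) - ((0 : ℝ) : ℂ) * w⁻¹)
      = log (w + 1) - log w - w⁻¹ := by push_cast; simp; ring
  rw [e] at h
  simpa using h

lemma norm_digammaTerm_le (n : ℕ) {z : ℂ} (hz : 0 < z.re) :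
    ‖digammaTerm n z‖ ≤ 2 * (1 / (‖z‖ + n) ^ 2) := by
  have hzn : 0 < (z + n).re := by
    simp only [add_re, natCast_re]; positivity
  refine (norm_log_add_one_sub_log_sub_inv_le hzn).trans ?_
  have h0 : 0 < ‖z‖ := norm_pos_iff.2 fun h => by simp [h] at hz
  have h1 : (‖z‖ + n) ^ 2 ≤ 2 * ‖z + n‖ ^ 2 := by
    have e : ‖z + n‖ ^ 2 = ‖z‖ ^ 2 + 2 * z.re * n + n ^ 2 := by
      rw [← normSq_eq_norm_sq, ← normSq_eq_norm_sq, normSq_apply, normSq_apply]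
      simp only [add_re, natCast_re, add_im, natCast_im, add_zero]
      ring
    have : 0 ≤ 2 * z.re * n := by positivity
    nlinarith [sq_nonneg (‖z‖ - n)]
  have h2 : 0 < ‖z + n‖ := norm_pos_iff.2 fun h => by simp [h] at hzn
  rw [mul_one_div, div_le_div_iff₀ (by positivity) (by positivity)]
  linarith

lemma sum_one_div_add_sq_le {a : ℝ} (ha : 1 ≤ a) (N : ℕ) :
    ∑ n ∈ Finset.range N, 2 * (1 / (a + n) ^ 2) ≤ 4 / a := by
  calc _ ≤ ∑ n ∈ Finset.range N, (4 / (a + n) - 4 / (a + (n + 1 : ℕ))) := by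
        refine Finset.sum_le_sum fun n _ => ?_
        have h : 1 ≤ a + n := by linarith [n.cast_nonneg (α := ℝ)]
        push_cast
        rw [← add_assoc]
        generalize a + (n : ℝ) = x at *
        rw [mul_one_div, div_sub_div _ _ (by positivity) (by positivity),
          div_le_div_iff₀ (by positivity) (by positivity)]
        nlinarith [mul_nonneg (by linarith : 0 ≤ x) (by linarith : 0 ≤ x - 1)]
    _ ≤ _ := by
        rw [Finset.sum_range_sub' (fun n : ℕ => 4 / (a + n))]
        simp only [Nat.cast_zero, add_zero, sub_le_self_iff]
        positivity

lemma one_le_norm_of_one_le_re {z : ℂ} (hz : 1 ≤ z.re) : 1 ≤ ‖z‖ :=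
  hz.trans ((le_abs_self _).trans (abs_re_le_norm z))

lemma summable_one_div_add_sq {a : ℝ} (ha : 1 ≤ a) :
    Summable fun n : ℕ => 2 * (1 / (a + n) ^ 2) :=
  summable_of_sum_range_le (fun n => by positivity) (sum_one_div_add_sq_le ha)

lemma summable_digammaTerm {z : ℂ} (hz : 1 ≤ z.re) : Summable fun n => digammaTerm n z :=
  Summable.of_norm_bounded (summable_one_div_add_sq (one_le_norm_of_one_le_re hz))
    fun n => norm_digammaTerm_le n (by linarith)

lemma norm_tsum_digammaTerm_le {z : ℂ} (hz : 1 ≤ z.re) :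
    ‖∑' n, digammaTerm n z‖ ≤ 4 / ‖z‖ := by
  have h1 := one_le_norm_of_one_le_re hz
  refine (tsum_of_norm_bounded (summable_one_div_add_sq h1).hasSum
    fun n => norm_digammaTerm_le n (by linarith)).trans ?_
  exact Real.tsum_le_of_sum_range_le (fun n => by positivity) (sum_one_div_add_sq_le h1)

lemma isOpen_re_gt (a : ℝ) : IsOpen {z : ℂ | a < z.re} := isOpen_lt continuous_const continuous_re

lemma differentiableOn_Gamma_re_pos : DifferentiableOn ℂ Gamma {z : ℂ | 0 < z.re} := fun z hz =>
  (differentiableAt_Gamma z fun m h => by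
    have hz : 0 < z.re := hz
    rw [h] at hz; simp at hz; linarith [m.cast_nonneg (α := ℝ)]).differentiableWithinAt

lemma differentiableAt_digamma {z : ℂ} (hz : 0 < z.re) : DifferentiableAt ℂ digamma z := by
  have hn : {z : ℂ | 0 < z.re} ∈ nhds z := (isOpen_re_gt 0).mem_nhds hz
  have h1 := differentiableOn_Gamma_re_pos.deriv (isOpen_re_gt 0)
  rw [digamma_def]
  exact (h1.differentiableAt hn).div (differentiableOn_Gamma_re_pos.differentiableAt hn)
    (Gamma_ne_zero_of_re_pos hz)

lemma digamma_ofReal_bounds {x : ℝ} (hx : 1 < x) :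
    ∃ r : ℝ, digamma x = r ∧ Real.log (x - 1) ≤ r ∧ r ≤ Real.log x := by
  have hx0 : 0 < x := by linarith
  have hcd : HasDerivAt Gamma (deriv Gamma (x : ℂ)) (x : ℂ) :=
    (differentiableOn_Gamma_re_pos.differentiableAt
      ((isOpen_re_gt 0).mem_nhds (by simpa using hx0))).hasDerivAt
  have hrd : HasDerivAt Real.Gamma (deriv Gamma (x : ℂ)).re x := by
    simpa [Complex.Gamma_ofReal] using hcd.real_of_complex
  have hG : 0 < Real.Gamma x := Real.Gamma_pos_of_pos hx0
  have hderiv : deriv Gamma (x : ℂ) = ((deriv Gamma (x : ℂ)).re : ℂ) := by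
    have h1 := hcd.comp_ofReal
    have h2 := hrd.ofReal_comp
    simp only [Complex.Gamma_ofReal] at h1
    exact h1.unique h2
  have hlog : HasDerivAt (Real.log ∘ Real.Gamma) ((deriv Gamma (x : ℂ)).re / Real.Gamma x) x :=
    hrd.log hG.ne'
  refine ⟨(deriv Gamma (x : ℂ)).re / Real.Gamma x, ?_, ?_, ?_⟩
  · rw [digamma_def, logDeriv_apply, Complex.Gamma_ofReal, ofReal_div, ← hderiv]
  · have h := Real.convexOn_log_Gamma.slope_le_of_hasDerivAt (x := x - 1) (y := x)
      (by simp; linarith) (by simpa using hx0) (by linarith) hlog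
    rw [slope_def_field] at h
    have e : Real.Gamma x = (x - 1) * Real.Gamma (x - 1) := by
      have := Real.Gamma_add_one (s := x - 1) (by linarith)
      rwa [sub_add_cancel] at this
    have hG' : 0 < Real.Gamma (x - 1) := Real.Gamma_pos_of_pos (by linarith)
    rw [Function.comp_apply, Function.comp_apply, sub_sub_cancel, div_one] at h
    rw [show Real.log (Real.Gamma x) = Real.log (x - 1) + Real.log (Real.Gamma (x - 1)) by
      rw [e, Real.log_mul (by linarith) hG'.ne']] at h
    linarith
  · have h := Real.convexOn_log_Gamma.le_slope_of_hasDerivAt (x := x) (y := x + 1)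
      (by simpa using hx0) (by simp; linarith) (by linarith) hlog
    rw [slope_def_field, Function.comp_apply, Function.comp_apply, add_sub_cancel_left, div_one,
      Real.Gamma_add_one hx0.ne', Real.log_mul hx0.ne' hG.ne'] at h
    linarith

lemma digamma_sub_log_add_one {z : ℂ} (hz : 0 < z.re) :
    digamma (z + 1) - log (z + 1) = digamma z - log z - digammaTerm 0 z := by
  rw [digamma_apply_add_one z fun m h => by
    rw [h] at hz; simp at hz; linarith [m.cast_nonneg (α := ℝ)]]
  simp only [digammaTerm, Nat.cast_zero, add_zero]
  ring

lemma digamma_sub_log_eq_sum_add {z : ℂ} (hz : 0 < z.re) (N : ℕ) :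
    digamma z - log z
      = ∑ n ∈ Finset.range N, digammaTerm n z + (digamma (z + N) - log (z + N)) := by
  induction N with
  | zero => simp
  | succ N ih =>
    have hzN : 0 < (z + N).re := by simp only [add_re, natCast_re]; positivity
    have h := digamma_sub_log_add_one hzN
    have e : digammaTerm 0 (z + N) = digammaTerm N z := by simp [digammaTerm]
    rw [ih, Finset.sum_range_succ]
    push_cast
    rw [← add_assoc, h, e]
    ring

lemma digamma_sub_log_eq_tsum_ofReal {x : ℝ} (hx : 1 ≤ x) :
    digamma x - log x = ∑' n, digammaTerm n (x : ℂ) := by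
  have hx0 : 0 < ((x : ℝ) : ℂ).re := by simp; linarith
  have h1 := (summable_digammaTerm (z := x) (by simpa using hx)).hasSum.tendsto_sum_nat
  have h2 : Tendsto (fun N : ℕ => digamma ((x : ℂ) + N) - log ((x : ℂ) + N)) atTop (nhds 0) := by
    have hb : ∀ᶠ N : ℕ in atTop, ‖digamma ((x : ℂ) + N) - log ((x : ℂ) + N)‖ ≤ 1 / (N : ℝ) := by
      filter_upwards [eventually_ge_atTop 1] with N hN
      have hN' : (1 : ℝ) ≤ N := by exact_mod_cast hN
      obtain ⟨r, h1, h2, h3⟩ := digamma_ofReal_bounds (x := x + N) (by linarith)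
      have e : ((x : ℂ) + N) = ((x + N : ℝ) : ℂ) := by push_cast; rfl
      rw [e, h1, ← ofReal_log (by linarith), ← ofReal_sub, norm_real, Real.norm_eq_abs,
        abs_of_nonpos (by linarith)]
      have h4 : Real.log (x + N) - Real.log (x + N - 1) ≤ 1 / N := by
        rw [← Real.log_div (by linarith) (by linarith)]
        refine (Real.log_le_sub_one_of_pos (div_pos (by linarith) (by linarith))).trans ?_
        rw [div_sub_one (by linarith), sub_sub_cancel]
        exact one_div_le_one_div_of_le (by linarith) (by linarith)
      linarith
    exact squeeze_zero_norm' hb tendsto_one_div_atTop_nhds_zero_nat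
  have h3 := h1.add h2
  simp_rw [← digamma_sub_log_eq_sum_add hx0, add_zero] at h3
  exact tendsto_nhds_unique tendsto_const_nhds h3

lemma differentiableOn_digammaTerm (n : ℕ) :
    DifferentiableOn ℂ (digammaTerm n) {z : ℂ | 1 < z.re} := by
  intro z hz
  have hz : 1 < z.re := hz
  have h1 : 0 < (z + n).re := by simp only [add_re, natCast_re]; positivity
  have h2 : z + n + 1 ∈ slitPlane := Or.inl (by simp only [add_re, one_re] at *; linarith)
  have h3 : z + n ∈ slitPlane := Or.inl h1
  have h4 : z + n ≠ 0 := slitPlane_ne_zero h3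
  unfold digammaTerm
  have d : DifferentiableAt ℂ (fun z : ℂ => z + n) z := by fun_prop
  exact ((((d.add_const 1).clog h2).sub (d.clog h3)).sub (d.inv h4)).differentiableWithinAt

lemma digamma_sub_log_eq_tsum {z : ℂ} (hz : 1 < z.re) :
    digamma z - log z = ∑' n, digammaTerm n z := by
  have hU := isOpen_re_gt 1
  have hf : DifferentiableOn ℂ (fun z => digamma z - log z) {z : ℂ | 1 < z.re} := fun w hw => by
    have hw : 1 < w.re := hw
    exact ((differentiableAt_digamma (by linarith)).sub
      (differentiableAt_id.clog (Or.inl (by simp; linarith)))).differentiableWithinAt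
  have hg : DifferentiableOn ℂ (fun z => ∑' n, digammaTerm n z) {z : ℂ | 1 < z.re} :=
    differentiableOn_tsum_of_summable_norm (summable_one_div_add_sq le_rfl)
      differentiableOn_digammaTerm hU fun n w hw => by
        have hw : 1 < w.re := hw
        refine (norm_digammaTerm_le n (by linarith)).trans ?_
        have := one_le_norm_of_one_le_re hw.le
        gcongr
  refine (hf.analyticOnNhd hU).eqOn_of_preconnected_of_frequently_eq (hg.analyticOnNhd hU)
    (convex_halfSpace_re_gt 1).isPreconnected (z₀ := 2) (by simp) ?_ hz
  have ht : Tendsto (fun x : ℝ => (x : ℂ)) (nhdsWithin 2 {2}ᶜ) (nhdsWithin 2 {2}ᶜ) := by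
    refine tendsto_nhdsWithin_iff.2 ⟨?_, ?_⟩
    · exact (Complex.continuous_ofReal.tendsto' 2 2 (by simp)).mono_left nhdsWithin_le_nhds
    · filter_upwards [self_mem_nhdsWithin] with x hx
      simp only [Set.mem_compl_iff, Set.mem_singleton_iff] at hx ⊢
      exact_mod_cast hx
  refine ht.frequently (Eventually.frequently ?_)
  filter_upwards [nhdsWithin_le_nhds (lt_mem_nhds (by norm_num : (1 : ℝ) < 2))] with x hx
  exact digamma_sub_log_eq_tsum_ofReal (le_of_lt hx)

/-- Stirling's estimate for the digamma function in the right half-plane. -/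
lemma norm_digamma_sub_log_le {z : ℂ} (hz : 0 < z.re) :
    ‖digamma z - log z‖ ≤ 4 / ‖z + 1‖ + 1 / ‖z‖ ^ 2 := by
  have h1 : 1 < (z + 1).re := by simp; linarith
  have h2 := digamma_sub_log_add_one hz
  have h3 : digamma z - log z = ∑' n, digammaTerm n (z + 1) + digammaTerm 0 z := by
    rw [← digamma_sub_log_eq_tsum h1, h2]; ring
  rw [h3]
  refine (norm_add_le _ _).trans (add_le_add (norm_tsum_digammaTerm_le h1.le) ?_)
  have := norm_log_add_one_sub_log_sub_inv_le hz
  simpa [digammaTerm] using this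

lemma isOpen_strip : IsOpen {z : ℂ | |z.im| < 1 / 2} :=
  isOpen_lt (continuous_abs.comp continuous_im) continuous_const

lemma re_quarter_add (z : ℂ) : (1 / 4 + I * z / 2).re = 1 / 4 - z.im / 2 := by
  rw [show (1 / 4 + I * z / 2 : ℂ) = ((1 / 4 : ℝ) : ℂ) + I * z / ((2 : ℝ) : ℂ) by push_cast; rfl,
    add_re, div_ofReal_re, I_mul_re, ofReal_re]
  ring

lemma re_quarter_sub (z : ℂ) : (1 / 4 - I * z / 2).re = 1 / 4 + z.im / 2 := by
  have := re_quarter_add (-z)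
  rw [neg_im] at this
  rw [show (1 / 4 - I * z / 2 : ℂ) = 1 / 4 + I * (-z) / 2 by ring, this]
  ring

lemma differentiableAt_thetaDeriv {z : ℂ} (hz : |z.im| < 1 / 2) :
    DifferentiableAt ℂ thetaDeriv z := by
  rw [abs_lt] at hz
  have h1 : DifferentiableAt ℂ (fun z : ℂ => digamma (1 / 4 + I * z / 2)) z :=
    (differentiableAt_digamma (by rw [re_quarter_add]; linarith)).comp z
      (f := fun z : ℂ => 1 / 4 + I * z / 2) (by fun_prop)
  have h2 : DifferentiableAt ℂ (fun z : ℂ => digamma (1 / 4 - I * z / 2)) z :=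
    (differentiableAt_digamma (by rw [re_quarter_sub]; linarith)).comp z
      (f := fun z : ℂ => 1 / 4 - I * z / 2) (by fun_prop)
  unfold thetaDeriv
  exact ((h1.add h2).div_const 4).const_add _

lemma differentiableOn_thetaDeriv : DifferentiableOn ℂ thetaDeriv {z : ℂ | |z.im| < 1 / 2} :=
  fun _ hz => (differentiableAt_thetaDeriv hz).differentiableWithinAt

lemma abs_im_ofReal_mul_le {s : ℝ} (hs : s ∈ Set.Icc (0 : ℝ) 1) (z : ℂ) :
    |((s : ℂ) * z).im| ≤ |z.im| := by
  rw [im_ofReal_mul, abs_mul, abs_of_nonneg hs.1]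
  exact mul_le_of_le_one_left (abs_nonneg _) hs.2

lemma hasDerivAt_theta {z : ℂ} (hz : |z.im| < 1 / 2) : HasDerivAt theta (thetaDeriv z) z := by
  set S : Set ℂ := {z : ℂ | |z.im| < 1 / 2} with hS
  obtain ⟨ε, hε, hball⟩ := Metric.nhds_basis_closedBall.mem_iff.1 (isOpen_strip.mem_nhds hz)
  have hcd : ContinuousOn (deriv thetaDeriv) S :=
    (differentiableOn_thetaDeriv.deriv isOpen_strip).continuousOn
  have hcg : ContinuousOn thetaDeriv S := differentiableOn_thetaDeriv.continuousOn
  set F' : ℂ → ℝ → ℂ := fun w s =>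
    thetaDeriv ((s : ℂ) * w) + w * (deriv thetaDeriv ((s : ℂ) * w) * s) with hF'
  have hmaps : Set.MapsTo (fun p : ℂ × ℝ => (p.2 : ℂ) * p.1)
      (Metric.closedBall z ε ×ˢ Set.Icc (0 : ℝ) 1) S := fun p hp =>
    (abs_im_ofReal_mul_le hp.2 p.1).trans_lt (hball hp.1)
  have hcF' : ContinuousOn (fun p : ℂ × ℝ => F' p.1 p.2)
      (Metric.closedBall z ε ×ˢ Set.Icc (0 : ℝ) 1) := by
    have hm : ContinuousOn (fun p : ℂ × ℝ => (p.2 : ℂ) * p.1)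
      (Metric.closedBall z ε ×ˢ Set.Icc (0 : ℝ) 1) := by fun_prop
    have e1 := hcg.comp hm hmaps
    have e2 := hcd.comp hm hmaps
    exact e1.add (continuousOn_fst.mul (e2.mul (by fun_prop)))
  obtain ⟨C, hC⟩ := ((isCompact_closedBall z ε).prod isCompact_Icc).exists_bound_of_continuousOn hcF'
  have hcont : ∀ w ∈ Metric.closedBall z ε,
      ContinuousOn (fun s : ℝ => w * thetaDeriv ((s : ℂ) * w)) (Set.Icc 0 1) := fun w hw =>
    continuousOn_const.mul (hcg.comp (by fun_prop) fun s hs =>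
      (abs_im_ofReal_mul_le hs w).trans_lt (hball hw))
  have hcontF' : ContinuousOn (F' z) (Set.Icc 0 1) :=
    hcF'.comp (f := fun s : ℝ => (z, s)) (by fun_prop) fun s hs =>
      ⟨Metric.mem_closedBall_self hε.le, hs⟩
  have huIoc : ∀ {s : ℝ}, s ∈ Set.uIoc (0 : ℝ) 1 → s ∈ Set.Icc (0 : ℝ) 1 := fun hs => by
    rw [Set.uIoc_of_le zero_le_one] at hs
    exact Set.Ioc_subset_Icc_self hs
  have hda : ∀ s ∈ Set.Icc (0 : ℝ) 1, ∀ w ∈ Metric.closedBall z ε,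
      HasDerivAt thetaDeriv (deriv thetaDeriv ((s : ℂ) * w)) ((s : ℂ) * w) := fun s hs w hw =>
    (differentiableAt_thetaDeriv
      ((abs_im_ofReal_mul_le hs w).trans_lt (hball hw))).hasDerivAt
  have key := intervalIntegral.hasDerivAt_integral_of_dominated_loc_of_deriv_le
    (F := fun w s => w * thetaDeriv ((s : ℂ) * w)) (F' := F') (x₀ := z) (a := 0) (b := 1)
    (μ := MeasureTheory.volume) (bound := fun _ => C)
    (Metric.closedBall_mem_nhds z hε)
    (by
      filter_upwards [Metric.closedBall_mem_nhds z hε] with w hw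
      rw [Set.uIoc_of_le zero_le_one]
      exact ((hcont w hw).mono Set.Ioc_subset_Icc_self).aestronglyMeasurable measurableSet_Ioc)
    (ContinuousOn.intervalIntegrable (by
      rw [Set.uIcc_of_le zero_le_one]
      exact hcont z (Metric.mem_closedBall_self hε.le)))
    (by
      rw [Set.uIoc_of_le zero_le_one]
      exact (hcontF'.mono Set.Ioc_subset_Icc_self).aestronglyMeasurable measurableSet_Ioc)
    (Eventually.of_forall fun s hs w hw => hC (w, s) ⟨hw, huIoc hs⟩)
    intervalIntegrable_const
    (Eventually.of_forall fun s hs w hw => by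
      have h1 : HasDerivAt (fun w : ℂ => (s : ℂ) * w) s w := by
        simpa using (hasDerivAt_id w).const_mul (s : ℂ)
      have h2 := (hasDerivAt_id w).mul ((hda s (huIoc hs) w hw).comp w h1)
      exact h2.congr_deriv (by simp [hF']))
  have hint : ∫ s in (0 : ℝ)..1, F' z s = thetaDeriv z := by
    have := intervalIntegral.integral_eq_sub_of_hasDerivAt (a := 0) (b := 1)
      (f := fun s : ℝ => (s : ℂ) * thetaDeriv ((s : ℂ) * z)) (f' := F' z)
      (fun s hs => by
        rw [Set.uIcc_of_le zero_le_one] at hs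
        have h1 : HasDerivAt (fun s : ℝ => (s : ℂ) * z) (1 * z) s :=
          (Complex.ofRealCLM.hasDerivAt (x := s)).mul_const z
        have h2 : HasDerivAt (fun s : ℝ => (s : ℂ)) 1 s := Complex.ofRealCLM.hasDerivAt (x := s)
        have h3 := h2.mul ((hda s hs z (Metric.mem_closedBall_self hε.le)).comp s h1)
        refine h3.congr_deriv ?_
        simp [hF']; ring)
      (ContinuousOn.intervalIntegrable (by rw [Set.uIcc_of_le zero_le_one]; exact hcontF'))
    rw [this]; simp
  have := key.2
  rw [hint] at this
  exact this

lemma digamma_conj (z : ℂ) : digamma ((starRingEnd ℂ) z) = (starRingEnd ℂ) (digamma z) := by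
  have h : (starRingEnd ℂ) ∘ Gamma ∘ (starRingEnd ℂ) = Gamma := by
    ext w; simp [Gamma_conj]
  have h2 : deriv Gamma ((starRingEnd ℂ) z) = (starRingEnd ℂ) (deriv Gamma z) := by
    conv_lhs => rw [← h]
    rw [deriv_conj_conj]
    simp
  rw [digamma_def, logDeriv_apply, logDeriv_apply, h2, Gamma_conj, map_div₀]

lemma conj_quarter_add (u : ℝ) :
    (starRingEnd ℂ) (1 / 4 + I * u / 2) = 1 / 4 - I * u / 2 := by
  simp [map_ofNat]
  ring

lemma thetaDeriv_ofReal_im (u : ℝ) : (thetaDeriv u).im = 0 := by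
  rw [← conj_eq_iff_im, thetaDeriv, ← conj_quarter_add, digamma_conj]
  simp only [map_add, map_div₀, map_neg, conj_ofReal, conj_conj, map_ofNat]
  ring

lemma theta_ofReal_im (u : ℝ) : (theta u).im = 0 := by
  have h : ∀ s : ℝ, (u : ℂ) * thetaDeriv ((s : ℂ) * u)
      = ((u * (thetaDeriv ((s * u : ℝ) : ℂ)).re : ℝ) : ℂ) := fun s => by
    rw [← ofReal_mul]
    apply Complex.ext <;> simp [thetaDeriv_ofReal_im, -ofReal_mul]
  unfold theta
  simp_rw [h]
  rw [intervalIntegral.integral_ofReal, ofReal_im]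

lemma norm_exp_I_mul_theta_ofReal (u : ℝ) : ‖cexp (I * theta u)‖ = 1 := by
  rw [norm_exp, I_mul_re, theta_ofReal_im]; simp

lemma norm_digamma_le {δ : ℝ} (hδ : 0 < δ) {z : ℂ} (hz : δ ≤ z.re) {R : ℝ} (hR : ‖z‖ ≤ R)
    (hR1 : 1 ≤ R) : ‖digamma z‖ ≤ |Real.log δ| + Real.log R + Real.pi + 4 + 1 / δ ^ 2 := by
  have hz0 : 0 < z.re := hδ.trans_le hz
  have hδz : δ ≤ ‖z‖ := hz.trans ((le_abs_self _).trans (abs_re_le_norm z))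
  have hz1 : 1 ≤ ‖z + 1‖ := one_le_norm_of_one_le_re (by simp; linarith)
  have h1 := norm_digamma_sub_log_le hz0
  have h2 : ‖log z‖ ≤ |Real.log δ| + Real.log R + Real.pi := by
    refine (norm_le_abs_re_add_abs_im _).trans (add_le_add ?_ ?_)
    · rw [log_re, abs_le]
      have e1 := Real.log_le_log hδ hδz
      have e2 := Real.log_le_log (hδ.trans_le hδz) hR
      have e3 := Real.log_nonneg hR1
      have e4 := neg_abs_le (Real.log δ)
      have e5 := abs_nonneg (Real.log δ)
      constructor <;> linarith
    · rw [log_im]; exact abs_arg_le_pi z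
  have h3 : 4 / ‖z + 1‖ ≤ 4 := div_le_self (by norm_num) hz1
  have h4 : 1 / ‖z‖ ^ 2 ≤ 1 / δ ^ 2 := by gcongr
  calc ‖digamma z‖ = ‖(digamma z - log z) + log z‖ := by rw [sub_add_cancel]
    _ ≤ _ := (norm_add_le _ _).trans (by linarith)

lemma exists_norm_thetaDeriv_le {c : ℝ} (hc : c < 1 / 2) :
    ∃ K : ℝ, 0 ≤ K ∧ ∀ z : ℂ, |z.im| ≤ c → ‖thetaDeriv z‖ ≤ K + Real.log (2 + |z.re|) := by
  set δ : ℝ := 1 / 4 - c / 2 with hδ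
  have hδ0 : 0 < δ := by rw [hδ]; linarith
  set K₀ : ℝ := |Real.log δ| + Real.pi + 4 + 1 / δ ^ 2 with hK₀
  have hK₀0 : 0 ≤ K₀ := by have := Real.pi_pos; positivity
  refine ⟨|Real.log Real.pi| / 2 + K₀, by positivity, fun z hz => ?_⟩
  have hz2 := abs_le.1 hz
  have hn : ‖I * z / 2‖ ≤ (|z.re| + 1 / 2) / 2 := by
    rw [norm_div, norm_mul, norm_I, one_mul, Complex.norm_ofNat]
    gcongr
    exact (norm_le_abs_re_add_abs_im z).trans (by linarith)
  have hq : ‖(1 / 4 : ℂ)‖ = 1 / 4 := by simp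
  have h0 := abs_nonneg z.re
  have h1 := norm_digamma_le hδ0 (z := 1 / 4 + I * z / 2) (R := 2 + |z.re|)
    (by rw [re_quarter_add]; linarith) ((norm_add_le _ _).trans (by linarith)) (by linarith)
  have h2 := norm_digamma_le hδ0 (z := 1 / 4 - I * z / 2) (R := 2 + |z.re|)
    (by rw [re_quarter_sub]; linarith) ((norm_sub_le _ _).trans (by linarith)) (by linarith)
  have hlog : 0 ≤ Real.log (2 + |z.re|) := Real.log_nonneg (by linarith)
  unfold thetaDeriv
  refine (norm_add_le _ _).trans ?_
  rw [norm_div, norm_div, norm_neg, norm_real, Real.norm_eq_abs, Complex.norm_ofNat,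
    Complex.norm_ofNat]
  have h3 := norm_add_le (digamma (1 / 4 + I * z / 2)) (digamma (1 / 4 - I * z / 2))
  linarith

lemma exists_norm_exp_I_mul_theta_le {c : ℝ} (hc0 : 0 ≤ c) (hc : c < 1 / 2) :
    ∃ K : ℝ, 0 ≤ K ∧ ∀ z : ℂ, |z.im| ≤ c → ‖cexp (I * theta z)‖ ≤ K * (2 + |z.re|) := by
  obtain ⟨K, hK, hbd⟩ := exists_norm_thetaDeriv_le hc
  refine ⟨Real.exp K, (Real.exp_pos _).le, fun z hz => ?_⟩
  have hre : (z.re : ℂ) ∈ {w : ℂ | |w.im| ≤ c ∧ w.re = z.re} := by simp [hc0]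
  have hconv : Convex ℝ {w : ℂ | |w.im| ≤ c ∧ w.re = z.re} := by
    have e : {w : ℂ | |w.im| ≤ c ∧ w.re = z.re}
        = {w : ℂ | -c ≤ w.im} ∩ {w : ℂ | w.im ≤ c} ∩ {w : ℂ | z.re ≤ w.re} ∩
          {w : ℂ | w.re ≤ z.re} := by
      ext w
      simp only [Set.mem_ofPred_eq, Set.mem_inter_iff, abs_le]
      constructor
      · rintro ⟨⟨h1, h2⟩, h3⟩; exact ⟨⟨⟨h1, h2⟩, h3.ge⟩, h3.le⟩
      · rintro ⟨⟨⟨h1, h2⟩, h3⟩, h4⟩; exact ⟨⟨h1, h2⟩, le_antisymm h4 h3⟩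
    rw [e]
    exact (((convex_halfSpace_im_ge _).inter (convex_halfSpace_im_le _)).inter
      (convex_halfSpace_re_ge _)).inter (convex_halfSpace_re_le _)
  have h := Convex.norm_image_sub_le_of_norm_hasDerivWithin_le (𝕜 := ℂ) (f := theta)
    (f' := thetaDeriv) (s := {w : ℂ | |w.im| ≤ c ∧ w.re = z.re}) (x := z.re) (y := z)
    (C := K + Real.log (2 + |z.re|))
    (fun w hw => (hasDerivAt_theta (hw.1.trans_lt hc)).hasDerivWithinAt)
    (fun w hw => by have := hbd w hw.1; rwa [hw.2] at this)
    hconv hre ⟨hz, rfl⟩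
  have h0 : 0 < 2 + |z.re| := by positivity
  have hlog : 0 ≤ Real.log (2 + |z.re|) := Real.log_nonneg (by linarith [abs_nonneg z.re])
  have hzz : ‖z - z.re‖ ≤ 1 := by
    have : z - z.re = z.im * I := by
      apply Complex.ext <;> simp
    rw [this, norm_mul, norm_I, norm_real, Real.norm_eq_abs]
    linarith
  have hle : ‖theta z - theta z.re‖ ≤ K + Real.log (2 + |z.re|) :=
    h.trans (mul_le_of_le_one_right (by positivity) hzz)
  have e : I * theta z = I * (theta z - theta z.re) + I * theta z.re := by ring
  rw [e, Complex.exp_add, norm_mul, norm_exp_I_mul_theta_ofReal, mul_one]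
  calc ‖cexp (I * (theta z - theta z.re))‖ ≤ Real.exp ‖I * (theta z - theta z.re)‖ :=
        norm_exp_le_exp_norm _
    _ ≤ Real.exp (K + Real.log (2 + |z.re|)) := by
        rw [norm_mul, norm_I, one_mul]; gcongr
    _ = _ := by rw [Real.exp_add, Real.exp_log h0]

/-- Stirling's estimate for the derivative of the theta function on the real line. -/
lemma norm_thetaDeriv_sub_log_le {u : ℝ} (hu : 1 ≤ u) :
    ‖thetaDeriv u - ((Real.log (u / (2 * Real.pi)) / 2 : ℝ) : ℂ)‖ ≤ 7 / u := by
  have hu0 : 0 < u := by linarith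
  have hpi := Real.pi_pos
  set w : ℂ := 1 / 4 + I * u / 2 with hw
  have hwre : w.re = 1 / 4 := by rw [hw, re_quarter_add]; simp
  have hwim : w.im = u / 2 := by
    rw [hw, show (1 / 4 + I * u / 2 : ℂ) = ((1 / 4 : ℝ) : ℂ) + ((u / 2 : ℝ) : ℂ) * I by
      push_cast; ring]
    simp
  have hw' : (1 / 4 - I * u / 2 : ℂ) = (starRingEnd ℂ) w := (conj_quarter_add u).symm
  have hD := norm_digamma_sub_log_le (z := w) (by rw [hwre]; norm_num)
  have hn1 : u / 2 ≤ ‖w‖ := by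
    rw [← hwim]; exact (le_abs_self _).trans (abs_im_le_norm w)
  have hn2 : u / 2 ≤ ‖w + 1‖ := by
    have := (le_abs_self _).trans (abs_im_le_norm (w + 1))
    rwa [add_im, hwim, one_im, add_zero] at this
  have hD2 : ‖digamma w - log w‖ ≤ 12 / u := by
    refine hD.trans ?_
    calc _ ≤ 4 / (u / 2) + 1 / (u / 2) ^ 2 := by gcongr
      _ ≤ 4 / (u / 2) + 1 / (u / 2 * (1 / 2)) := by
          gcongr
          rw [sq]; gcongr
      _ = _ := by field_simp; norm_num
  set r : ℝ := (digamma w - log w).re with hr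
  have hrle : |r| ≤ 12 / u := (abs_re_le_norm _).trans hD2
  have hlogw : (log w).re = Real.log ‖w‖ := log_re w
  have hnw : ‖w‖ ^ 2 = 1 / 16 + u ^ 2 / 4 := by
    rw [← normSq_eq_norm_sq, normSq_apply, hwre, hwim]; ring
  have hd : |Real.log ‖w‖ - Real.log (u / 2)| ≤ 1 / u := by
    have hp : 0 < ‖w‖ := lt_of_lt_of_le (by positivity) hn1
    have h1 := Real.log_le_log (by positivity) hn1
    rw [abs_of_nonneg (by linarith)]
    have h2 : Real.log (‖w‖ ^ 2 / (u / 2) ^ 2) = 2 * (Real.log ‖w‖ - Real.log (u / 2)) := by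
      rw [Real.log_div (by positivity) (by positivity), Real.log_pow, Real.log_pow]
      push_cast; ring
    have h3 := Real.log_le_sub_one_of_pos (x := ‖w‖ ^ 2 / (u / 2) ^ 2) (by positivity)
    have h4 : ‖w‖ ^ 2 / (u / 2) ^ 2 - 1 = 1 / (4 * u * u) := by
      rw [hnw]; field_simp; ring
    have h5 : 1 / (4 * u * u) ≤ 1 / (1 * u) := by gcongr; linarith
    rw [h2, h4] at h3
    rw [one_mul] at h5
    have : 0 < 1 / u := by positivity
    linarith
  have hval : thetaDeriv u = ((-Real.log Real.pi / 2 + (r + Real.log ‖w‖) / 2 : ℝ) : ℂ) := by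
    rw [thetaDeriv, hw', digamma_conj, ← hw, add_conj]
    have : (digamma w).re = r + Real.log ‖w‖ := by rw [hr, sub_re, hlogw]; ring
    rw [this]
    push_cast; ring
  rw [hval, ← ofReal_sub, norm_real, Real.norm_eq_abs]
  have hl : Real.log (u / (2 * Real.pi)) = Real.log (u / 2) - Real.log Real.pi := by
    rw [← div_div, Real.log_div (by positivity) hpi.ne']
  rw [hl]
  have e7 : (7 : ℝ) / u = 12 / u / 2 + 1 / u := by field_simp; norm_num
  rw [e7]
  have : 0 < 1 / u := by positivity
  rw [abs_le] at *
  constructor <;> linarith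

lemma norm_theta_add_sub_le {t y : ℝ} (ht : 2 ≤ t) (hy : |y| ≤ t / 2) :
    ‖theta (t + y) - theta t - ((y * (Real.log (t / (2 * Real.pi)) / 2) : ℝ) : ℂ)‖
      ≤ |y| * (14 + |y|) / t := by
  have ht0 : 0 < t := by linarith
  have hpi := Real.pi_pos
  set L : ℝ := Real.log (t / (2 * Real.pi)) / 2 with hL
  have h := Convex.norm_image_sub_le_of_norm_hasDerivWithin_le
    (f := fun s : ℝ => theta ((t + s : ℝ) : ℂ) - ((s * L : ℝ) : ℂ))
    (f' := fun s : ℝ => thetaDeriv ((t + s : ℝ) : ℂ) - ((L : ℝ) : ℂ))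
    (s := Set.Icc (-|y|) |y|) (x := 0) (y := y) (C := (14 + |y|) / t)
    (fun s hs => by
      have h1 := (hasDerivAt_theta (z := ((t + s : ℝ) : ℂ)) (by simp)).comp_ofReal
      have h2 : HasDerivAt (fun s : ℝ => theta ((t + s : ℝ) : ℂ)) (thetaDeriv ((t + s : ℝ) : ℂ)) s :=
        HasDerivAt.comp_const_add t s h1
      have h3 : HasDerivAt (fun s : ℝ => ((s * L : ℝ) : ℂ)) ((1 * L : ℝ) : ℂ) s :=
        ((hasDerivAt_id s).mul_const L).ofReal_comp
      rw [one_mul] at h3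
      exact (h2.sub h3).hasDerivWithinAt)
    (fun s hs => by
      have hs' : |s| ≤ |y| := abs_le.2 hs
      have hs2 := abs_le.1 (hs'.trans hy)
      have hts : t / 2 ≤ t + s := by linarith
      have h1 := norm_thetaDeriv_sub_log_le (u := t + s) (by linarith)
      have h2 : |Real.log ((t + s) / (2 * Real.pi)) / 2 - L| ≤ |y| / t := by
        have e : Real.log ((t + s) / (2 * Real.pi)) / 2 - L
            = (Real.log (t + s) - Real.log t) / 2 := by
          rw [hL, Real.log_div (by linarith) (by positivity), Real.log_div (by linarith)
            (by positivity)]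
          ring
        rw [e]
        have u1 : Real.log (t + s) - Real.log t ≤ s / t := by
          rw [← Real.log_div (by linarith) (by linarith)]
          refine (Real.log_le_sub_one_of_pos (div_pos (by linarith) ht0)).trans_eq ?_
          field_simp; ring
        have u2 : s / (t + s) ≤ Real.log (t + s) - Real.log t := by
          rw [← Real.log_div (by linarith) (by linarith)]
          refine le_trans (le_of_eq ?_)
            (Real.one_sub_inv_le_log_of_pos (div_pos (by linarith) ht0))
          have : t + s ≠ 0 := by linarith
          field_simp; ring
        have u3 : s / t ≤ 2 * (|y| / t) := by
          rw [← mul_div_assoc]; gcongr; linarith [le_abs_self s, abs_nonneg y]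
        have u4 : -(2 * (|y| / t)) ≤ s / (t + s) := by
          have : |s / (t + s)| ≤ |y| / (t / 2) := by
            rw [abs_div, abs_of_pos (by linarith : 0 < t + s)]
            gcongr
          have e2 : |y| / (t / 2) = 2 * (|y| / t) := by field_simp
          rw [e2] at this
          exact (abs_le.1 this).1
        rw [abs_le]; constructor <;> linarith
      calc _ = ‖(thetaDeriv ((t + s : ℝ) : ℂ)
            - ((Real.log ((t + s) / (2 * Real.pi)) / 2 : ℝ) : ℂ))
            + ((Real.log ((t + s) / (2 * Real.pi)) / 2 - L : ℝ) : ℂ)‖ := by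
              congr 1; push_cast; ring
        _ ≤ 7 / (t + s) + |y| / t := (norm_add_le _ _).trans (by
              gcongr
              rwa [norm_real])
        _ ≤ 7 / (t / 2) + |y| / t := by gcongr
        _ = _ := by field_simp; ring)
    (convex_Icc _ _) (by simp) ⟨neg_abs_le y, le_abs_self y⟩
  simp only [add_zero, zero_mul, ofReal_zero, sub_zero, Real.norm_eq_abs] at h
  calc _ = ‖theta ((t + y : ℝ) : ℂ) - ((y * L : ℝ) : ℂ) - theta t‖ := by
        congr 1; push_cast; ring
    _ ≤ _ := h.trans_eq (by ring)

lemma norm_intervalIntegral_sub_le_of_differentiableAt {f : ℂ → ℂ} {b p q M : ℝ} (hb : 0 ≤ b)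
    (hpq : p ≤ q)
    (hf : ∀ x : ℂ, |x.re| ≤ b → -q ≤ x.im → x.im ≤ -p → DifferentiableAt ℂ f x)
    (hM : ∀ x : ℂ, |x.re| = b → -q ≤ x.im → x.im ≤ -p → ‖f x‖ ≤ M) :
    ‖(∫ y in (-b)..b, f (y - p * I)) - ∫ y in (-b)..b, f (y - q * I)‖ ≤ 2 * (q - p) * M := by
  have h := integral_boundary_rect_eq_zero_of_differentiableOn f ((-b : ℝ) + (-q : ℝ) * I)
    ((b : ℝ) + (-p : ℝ) * I) (fun x hx => by
      obtain ⟨h1, h2⟩ := hx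
      simp only [add_re, ofReal_re, mul_re, I_re, mul_zero, ofReal_im, I_im, mul_one, sub_self,
        add_zero, add_im, mul_im, zero_add, Set.mem_preimage] at h1 h2
      rw [Set.uIcc_of_le (by linarith)] at h1 h2
      exact (hf x (abs_le.2 h1) h2.1 h2.2).differentiableWithinAt)
  simp only [add_re, ofReal_re, mul_re, I_re, mul_zero, ofReal_im, I_im, mul_one, sub_self,
        add_zero, add_im, mul_im, zero_add] at h
  have hside : ∀ a : ℝ, |a| = b → ‖∫ y in (-q)..(-p), f (a + y * I)‖ ≤ M * (q - p) := by
    intro a ha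
    have := intervalIntegral.norm_integral_le_of_norm_le_const (a := -q) (b := -p) (C := M)
      (f := fun y : ℝ => f (a + y * I)) (fun y hy => by
        rw [Set.uIoc_of_le (by linarith)] at hy
        exact hM _ (by simpa using ha) (by simpa using hy.1.le) (by simpa using hy.2))
    rwa [abs_of_nonneg (by linarith), show -p - -q = q - p by ring] at this
  have e : ∀ r : ℝ, (∫ y in (-b)..b, f (y - r * I)) = ∫ y in (-b)..b, f (y + (-r : ℝ) * I) :=
    fun r => by
      congr 1; ext y; push_cast; ring_nf
  have h1 := hside b (abs_of_nonneg hb)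
  have h2 := hside (-b) (by rw [abs_neg, abs_of_nonneg hb])
  rw [e p, e q]
  have e2 : (∫ y in (-b)..b, f (y + (-p : ℝ) * I)) - ∫ y in (-b)..b, f (y + (-q : ℝ) * I)
      = I * (∫ y in (-q)..(-p), f ((b : ℝ) + y * I))
        - I * ∫ y in (-q)..(-p), f ((-b : ℝ) + y * I) := by
    simp only [smul_eq_mul] at h
    linear_combination -h
  rw [e2]
  refine (norm_sub_le _ _).trans ?_
  rw [norm_mul, norm_mul, norm_I]
  linarith

lemma sinh_pi_mul_ne_zero {x : ℂ} (h1 : -2 < x.im) (h2 : x.im < 0 ∨ x.im = 0 ∧ x ≠ 0) :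
    sinh ((Real.pi : ℂ) * x / 2) ≠ 0 := by
  have hpi := Real.pi_pos
  intro h
  have hx : (Real.pi : ℂ) * x / 2
      = ((Real.pi * x.re / 2 : ℝ) : ℂ) + ((Real.pi * x.im / 2 : ℝ) : ℂ) * I := by
    conv_lhs => rw [← re_add_im x]
    push_cast; ring
  rw [hx, sinh_add, sinh_mul_I, cosh_mul_I, ← ofReal_sinh, ← ofReal_cosh, ← ofReal_sin,
    ← ofReal_cos] at h
  have hre := congrArg Complex.re h
  have him := congrArg Complex.im h
  simp [-ofReal_sinh, -ofReal_cosh, -ofReal_sin, -ofReal_cos] at hre him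
  rcases h2 with h2 | ⟨h2, h3⟩
  · have hs : Real.sin (Real.pi * x.im / 2) < 0 :=
      Real.sin_neg_of_neg_of_neg_pi_lt (by nlinarith) (by nlinarith)
    rcases him with him | him
    · linarith [Real.cosh_pos (Real.pi * x.re / 2)]
    · linarith
  · rw [h2] at hre
    have hre0 : x.re ≠ 0 := fun h0 => h3 (Complex.ext h0 h2)
    simp [hre0] at hre

lemma norm_sinh_ge (w : ℂ) : Real.sinh |w.re| ≤ ‖sinh w‖ := by
  have h : ∀ w : ℂ, 0 ≤ w.re → Real.sinh w.re ≤ ‖sinh w‖ := fun w _ => by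
    rw [Complex.sinh, Real.sinh_eq, norm_div, Complex.norm_ofNat]
    gcongr
    have := norm_sub_norm_le (cexp w) (cexp (-w))
    rwa [norm_exp, norm_exp, neg_re] at this
  rcases le_total 0 w.re with h0 | h0
  · rw [abs_of_nonneg h0]; exact h w h0
  · rw [abs_of_nonpos h0]
    have := h (-w) (by simpa using h0)
    rwa [sinh_neg, norm_neg, neg_re] at this

lemma re_pi_mul_div_two (x : ℂ) : ((Real.pi : ℂ) * x / 2).re = Real.pi * x.re / 2 := by
  rw [show (Real.pi : ℂ) * x / 2 = ((Real.pi / 2 : ℝ) : ℂ) * x by push_cast; ring, re_ofReal_mul]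
  ring

lemma norm_kernel_le_exp {x : ℂ} (hx : 1 ≤ |x.re|) :
    ‖kernel x‖ ≤ 8 * Real.exp (-(3 / 2 * |x.re|)) := by
  have hpi := Real.pi_gt_three
  have hpi' := Real.pi_lt_four
  have h := norm_sinh_ge ((Real.pi : ℂ) * x / 2)
  rw [re_pi_mul_div_two, abs_div, abs_mul, abs_of_pos Real.pi_pos, abs_two] at h
  set a := |x.re|
  have h1 : Real.exp (3 / 2 * a) / 4 ≤ Real.sinh (Real.pi * a / 2) := by
    have e0 : Real.sinh (3 / 2 * a) ≤ Real.sinh (Real.pi * a / 2) := by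
      rw [Real.sinh_le_sinh]; nlinarith
    refine le_trans ?_ e0
    rw [Real.sinh_eq]
    have e1 : Real.exp (-(3 / 2 * a)) * 2 ≤ Real.exp (3 / 2 * a) := by
      have : 2 ≤ Real.exp (3 * a) := by linarith [Real.add_one_le_exp (3 * a)]
      calc Real.exp (-(3 / 2 * a)) * 2 ≤ Real.exp (-(3 / 2 * a)) * Real.exp (3 * a) := by gcongr
        _ = _ := by rw [← Real.exp_add]; ring_nf
    linarith
  have h2 : Real.exp (3 / 2 * a) / 4 ≤ ‖sinh ((Real.pi : ℂ) * x / 2)‖ := h1.trans h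
  have h0 := Real.exp_pos (3 / 2 * a)
  rw [kernel, norm_div, norm_mul, norm_real, Real.norm_of_nonneg Real.pi_pos.le,
    Complex.norm_ofNat, Real.exp_neg, div_le_iff₀ (by linarith)]
  calc Real.pi ≤ 8 * (Real.exp (3 / 2 * a))⁻¹ * (2 * (Real.exp (3 / 2 * a) / 4)) := by
        field_simp; linarith
    _ ≤ _ := by gcongr

lemma norm_kernel_ofReal_le {y : ℝ} (hy : y ≠ 0) : ‖kernel y‖ ≤ 1 / |y| := by
  have hpi := Real.pi_pos
  have hy0 : 0 < |y| := abs_pos.2 hy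
  have h := norm_sinh_ge ((Real.pi : ℂ) * y / 2)
  rw [re_pi_mul_div_two, ofReal_re, abs_div, abs_mul, abs_of_pos hpi, abs_two] at h
  have h1 : Real.pi * |y| / 2 ≤ Real.sinh (Real.pi * |y| / 2) :=
    Real.self_le_sinh_iff.2 (by positivity)
  have h2 := h1.trans h
  have h3 : 0 < Real.pi * |y| / 2 := by positivity
  rw [kernel, norm_div, norm_mul, norm_real, Real.norm_of_nonneg hpi.le,
    Complex.norm_ofNat, div_le_div_iff₀ (by linarith) hy0]
  linarith

lemma differentiableAt_kernel {x : ℂ} (h1 : -2 < x.im) (h2 : x.im < 0) :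
    DifferentiableAt ℂ kernel x := by
  have h := sinh_pi_mul_ne_zero h1 (Or.inl h2)
  unfold kernel
  have : (2 : ℂ) * sinh ((Real.pi : ℂ) * x / 2) ≠ 0 := mul_ne_zero two_ne_zero h
  fun_prop (disch := assumption)

/-- Near the simple pole of the kernel at `0`, a factor vanishing at `0` leaves a holomorphic
product. -/
lemma exists_differentiableAt_eq_mul_kernel {D : ℂ → ℂ} {c : ℝ}  (hc : c < 2)
    (hc0 : 0 < c) (hD : ∀ x : ℂ, |x.im| < c → DifferentiableAt ℂ D x) (hD0 : D 0 = 0) :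
    ∃ F : ℂ → ℂ, (∀ x : ℂ, -c < x.im → x.im ≤ 0 → DifferentiableAt ℂ F x) ∧
      ∀ x : ℂ, x ≠ 0 → F x = D x * kernel x := by
  have hpi := Real.pi_pos
  set s : ℂ → ℂ := fun x => sinh ((Real.pi : ℂ) * x / 2) with hs
  have hsd : Differentiable ℂ s := by fun_prop
  have hs' : deriv s 0 = (Real.pi : ℂ) / 2 := by
    have h1 : HasDerivAt (fun x : ℂ => (Real.pi : ℂ) * x / 2) ((Real.pi : ℂ) / 2) 0 := by
      simpa using ((hasDerivAt_id (0 : ℂ)).const_mul (Real.pi : ℂ)).div_const 2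
    have := h1.csinh
    simpa using this.deriv
  have hdS : ∀ x : ℂ, DifferentiableAt ℂ (dslope s 0) x := fun x =>
    ((differentiableOn_dslope (s := Set.univ) (c := (0 : ℂ)) Filter.univ_mem).2
      hsd.differentiableOn).differentiableAt Filter.univ_mem
  set V : Set ℂ := {x : ℂ | |x.im| < c} with hV
  have hVo : IsOpen V := isOpen_lt (continuous_abs.comp continuous_im) continuous_const
  have hdD : ∀ x ∈ V, DifferentiableAt ℂ (dslope D 0) x := fun x hx =>
    ((differentiableOn_dslope (hVo.mem_nhds (by simpa [hV] using hc0))).2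
      fun y hy => (hD y hy).differentiableWithinAt).differentiableAt (hVo.mem_nhds hx)
  refine ⟨fun x => dslope D 0 x * ((Real.pi : ℂ) / (2 * dslope s 0 x)), fun x h1 h2 => ?_,
    fun x hx => ?_⟩
  · have hne : dslope s 0 x ≠ 0 := by
      rcases eq_or_ne x 0 with rfl | hx
      · rw [dslope_same, hs']
        simp [hpi.ne']
      · rw [dslope_of_ne _ hx, slope_def_field]
        have h0 : s 0 = 0 := by simp [hs]
        rw [h0, sub_zero, sub_zero]
        refine div_ne_zero (sinh_pi_mul_ne_zero (by linarith) ?_) hx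
        rcases h2.lt_or_eq with h | h
        · exact Or.inl h
        · exact Or.inr ⟨h, hx⟩
    refine (hdD x (abs_lt.2 ⟨h1, by linarith⟩)).mul ?_
    exact (differentiableAt_const _).div ((hdS x).const_mul 2) (mul_ne_zero two_ne_zero hne)
  · simp only [dslope_of_ne _ hx, slope_def_field, hD0, sub_zero, kernel]
    have h0 : s 0 = 0 := by simp [hs]
    rw [h0, sub_zero]
    simp only [hs]
    rcases eq_or_ne (sinh ((Real.pi : ℂ) * x / 2)) 0 with h | h
    · simp [h]
    · field_simp

lemma half_add_I_mul_re (t : ℝ) (x : ℂ) : (1 / 2 + I * (t + x) : ℂ).re = 1 / 2 - x.im := by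
  rw [show (1 / 2 + I * (t + x) : ℂ) = ((1 / 2 : ℝ) : ℂ) + I * (t + x) by push_cast; rfl,
    add_re, ofReal_re, I_mul_re, add_im, ofReal_im, zero_add]
  ring

lemma half_add_I_mul_im (t : ℝ) (x : ℂ) : (1 / 2 + I * (t + x) : ℂ).im = t + x.re := by
  rw [show (1 / 2 + I * (t + x) : ℂ) = ((1 / 2 : ℝ) : ℂ) + I * (t + x) by push_cast; rfl,
    add_im, ofReal_im, I_mul_im, add_re, ofReal_re, zero_add]

lemma differentiableAt_zeta_half {t : ℝ} {x : ℂ} (h : (1 / 2 + I * (t + x) : ℂ) ≠ 1) :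
    DifferentiableAt ℂ (fun x : ℂ => riemannZeta (1 / 2 + I * (t + x))) x :=
  (differentiableAt_riemannZeta h).comp x (f := fun x : ℂ => 1 / 2 + I * (t + x)) (by fun_prop)

lemma half_add_I_mul_ne_one {t : ℝ} {x : ℂ} (h : 0 < t + x.re) :
    (1 / 2 + I * (t + x) : ℂ) ≠ 1 := fun h1 => by
  have := half_add_I_mul_im t x
  rw [h1] at this
  simp at this
  linarith

lemma norm_zeta_half_le {t : ℝ} (ht : 2 ≤ t) {x : ℂ} (hx : |x.re| ≤ t / 2) (h1 : -2 ≤ x.im)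
    (h2 : x.im ≤ 0) : ‖riemannZeta (1 / 2 + I * (t + x))‖ ≤ 20 * t := by
  have hx' := abs_le.1 hx
  set s : ℂ := 1 / 2 + I * (t + x) with hs
  have hre : s.re = 1 / 2 - x.im := half_add_I_mul_re t x
  have him : s.im = t + x.re := half_add_I_mul_im t x
  have h := norm_riemannZeta_le (s := s) (by linarith) (half_add_I_mul_ne_one (by linarith))
  have e1 : 1 ≤ ‖s - 1‖ := by
    have := (le_abs_self _).trans (abs_im_le_norm (s - 1))
    rw [sub_im, him, one_im] at this
    linarith
  have e2 : ‖s‖ ≤ 5 / 2 + 3 / 2 * t := by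
    refine (norm_le_abs_re_add_abs_im s).trans ?_
    rw [hre, him, abs_of_nonneg (by linarith), abs_of_nonneg (by linarith)]
    linarith
  have e3 := inv_le_one_of_one_le₀ e1
  linarith

lemma norm_ofReal_cpow_I_mul_le {τ : ℝ} (hτ : 1 ≤ τ) {x : ℂ} (h1 : -2 ≤ x.im) :
    ‖(τ : ℂ) ^ (I * x / 2)‖ ≤ τ := by
  have e : (I * x / 2).re = -x.im / 2 := by
    rw [show I * x / 2 = I * x / ((2 : ℝ) : ℂ) by push_cast; rfl, div_ofReal_re, I_mul_re]
  rw [norm_cpow_eq_rpow_re_of_pos (by linarith), e]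
  calc τ ^ (-x.im / 2) ≤ τ ^ (1 : ℝ) := Real.rpow_le_rpow_of_exponent_le hτ (by linarith)
    _ = τ := Real.rpow_one τ

lemma differentiableAt_ofReal_cpow_I_mul {τ : ℝ} (hτ : 0 < τ) (x : ℂ) :
    DifferentiableAt ℂ (fun x : ℂ => (τ : ℂ) ^ (I * x / 2)) x :=
  (by fun_prop : DifferentiableAt ℂ (fun x : ℂ => I * x / 2) x).const_cpow
    (Or.inl (by exact_mod_cast hτ.ne'))

/-- The integrand of `U`. -/
noncomputable def thetaIntegrand (t : ℝ) (x : ℂ) : ℂ :=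
  cexp (I * theta (t + x) - I * theta t) * riemannZeta (1 / 2 + I * (t + x)) * kernel x

/-- The integrand of the truncated integral. -/
noncomputable def powIntegrand (t : ℝ) (x : ℂ) : ℂ :=
  ((t / (2 * Real.pi) : ℝ) : ℂ) ^ (I * x / 2) * riemannZeta (1 / 2 + I * (t + x)) * kernel x

lemma differentiableAt_exp_theta {t : ℝ} {x : ℂ} (hx : |x.im| < 1 / 2) :
    DifferentiableAt ℂ (fun x : ℂ => cexp (I * theta (t + x) - I * theta t)) x := by
  have h : DifferentiableAt ℂ (fun x : ℂ => theta (t + x)) x :=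
    (hasDerivAt_theta (z := t + x) (by simpa using hx)).differentiableAt.comp x
      (f := fun x : ℂ => (t : ℂ) + x) (by fun_prop)
  exact ((h.const_mul I).sub_const _).cexp

lemma norm_exp_theta_sub (t : ℝ) (w : ℂ) :
    ‖cexp (I * theta w - I * theta t)‖ = ‖cexp (I * theta w)‖ := by
  rw [Complex.exp_sub, norm_div, norm_exp_I_mul_theta_ofReal, div_one]

lemma continuous_thetaIntegrand_line {c : ℝ} (hc0 : 0 < c) (hc : c < 1 / 2) (t : ℝ) :
    Continuous fun y : ℝ => thetaIntegrand t (y - c * I) := by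
  rw [continuous_iff_continuousAt]
  intro y
  have him : ((y : ℂ) - c * I).im = -c := by simp
  have hne : (1 / 2 + I * (t + ((y : ℂ) - c * I)) : ℂ) ≠ 1 := fun h => by
    have := half_add_I_mul_re t ((y : ℂ) - c * I)
    rw [h, him, one_re] at this
    linarith
  have h1 := ((differentiableAt_exp_theta (t := t) (x := (y : ℂ) - c * I)
    (by rw [him, abs_neg, abs_of_pos hc0]; exact hc)).mul (differentiableAt_zeta_half hne)).mul
    (differentiableAt_kernel (x := (y : ℂ) - c * I) (by rw [him]; linarith) (by rw [him]; linarith))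
  exact ContinuousAt.comp (f := fun y : ℝ => (y : ℂ) - c * I) h1.continuousAt (by fun_prop)

lemma exists_norm_thetaIntegrand_line_le {c : ℝ} (hc0 : 0 < c) (hc : c < 1 / 2) :
    ∃ K : ℝ, 0 ≤ K ∧ ∀ t : ℝ, 2 ≤ t → ∀ y : ℝ, 1 ≤ |y| →
      ‖thetaIntegrand t (y - c * I)‖ ≤ K * t ^ 2 * Real.exp (-|y|) := by
  obtain ⟨K, hK, hbd⟩ := exists_norm_exp_I_mul_theta_le hc0.le hc
  set m : ℝ := (1 / 2 - c)⁻¹ with hm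
  have hm0 : 0 ≤ m := inv_nonneg.2 (by linarith)
  refine ⟨512 * K * (m + 3), by positivity, fun t ht y hy => ?_⟩
  set x : ℂ := y - c * I with hx
  have hre : x.re = y := by simp [hx]
  have him : x.im = -c := by simp [hx]
  have h1 : ‖cexp (I * theta (t + x) - I * theta t)‖ ≤ K * (2 * t * (1 + |y|)) := by
    rw [norm_exp_theta_sub]
    refine (hbd (t + x) (by simp [him, abs_of_pos hc0])).trans ?_
    gcongr
    have e : ((t : ℂ) + x).re = t + y := by simp [hre]
    rw [e]
    have := abs_add_le t y
    rw [abs_of_pos (by linarith : 0 < t)] at this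
    nlinarith [abs_nonneg y]
  have h2 : ‖riemannZeta (1 / 2 + I * (t + x))‖ ≤ (m + 3) * (2 * t * (1 + |y|)) := by
    set s : ℂ := 1 / 2 + I * (t + x) with hs
    have hsre : s.re = 1 / 2 + c := by rw [hs, half_add_I_mul_re, him]; ring
    have hsim : s.im = t + y := by rw [hs, half_add_I_mul_im, hre]
    have hs1 : s ≠ 1 := fun h => by rw [h, one_re] at hsre; linarith
    refine (norm_riemannZeta_le (by linarith) hs1).trans ?_
    have e1 : ‖s - 1‖⁻¹ ≤ m := by
      refine inv_anti₀ (by linarith) ?_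
      have := (neg_le_abs _).trans (abs_re_le_norm (s - 1))
      rw [sub_re, hsre, one_re] at this
      linarith
    have e2 : ‖s‖ ≤ 1 + t + |y| := by
      refine (norm_le_abs_re_add_abs_im s).trans ?_
      rw [hsre, hsim, abs_of_pos (by linarith)]
      have := abs_add_le t y
      rw [abs_of_pos (by linarith : 0 < t)] at this
      linarith
    have e3 : 1 + t + |y| ≤ 2 * t * (1 + |y|) := by nlinarith [abs_nonneg y]
    have e4 : 1 ≤ 2 * t * (1 + |y|) := by nlinarith [abs_nonneg y]
    nlinarith
  have h3 := norm_kernel_le_exp (x := x) (by rwa [hre])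
  rw [hre] at h3
  have h4 : (1 + |y|) ^ 2 ≤ 16 * Real.exp (1 / 2 * |y|) := by
    have e1 : 1 + |y| ≤ 4 * Real.exp (1 / 4 * |y|) := by
      linarith [Real.add_one_le_exp (1 / 4 * |y|), abs_nonneg y]
    calc (1 + |y|) ^ 2 ≤ (4 * Real.exp (1 / 4 * |y|)) ^ 2 := by gcongr
      _ = _ := by rw [mul_pow, ← Real.exp_nat_mul]; push_cast; ring_nf
  rw [thetaIntegrand, norm_mul, norm_mul]
  calc _ ≤ K * (2 * t * (1 + |y|)) * ((m + 3) * (2 * t * (1 + |y|)))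
        * (8 * Real.exp (-(3 / 2 * |y|))) := by gcongr
    _ = 32 * K * (m + 3) * t ^ 2 * Real.exp (-(3 / 2 * |y|)) * (1 + |y|) ^ 2 := by ring
    _ ≤ 32 * K * (m + 3) * t ^ 2 * Real.exp (-(3 / 2 * |y|)) * (16 * Real.exp (1 / 2 * |y|)) := by
        gcongr
    _ = 512 * K * (m + 3) * t ^ 2 * (Real.exp (-(3 / 2 * |y|)) * Real.exp (1 / 2 * |y|)) := by ring
    _ = _ := by rw [← Real.exp_add]; ring_nf

lemma norm_integral_sub_intervalIntegral_le {f : ℝ → ℂ} (hf : Continuous f) {K b : ℝ} (hb : 1 ≤ b)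
    (hK : ∀ y : ℝ, 1 ≤ |y| → ‖f y‖ ≤ K * Real.exp (-|y|)) :
    ‖(∫ y, f y) - ∫ y in (-b)..b, f y‖ ≤ 2 * K * Real.exp (-b) := by
  have hbI : MeasureTheory.IntegrableOn (fun y => K * Real.exp y) (Set.Iic (-b)) :=
    (integrableOn_exp_Iic (-b)).const_mul K
  have hbI' : MeasureTheory.IntegrableOn (fun y => K * Real.exp (-y)) (Set.Ioi b) :=
    (integrableOn_exp_neg_Ioi b).const_mul K
  have bd1 : ∀ y ∈ Set.Iic (-b), ‖f y‖ ≤ K * Real.exp y := fun y hy => by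
    have hy : y ≤ -b := hy
    have h := hK y (by rw [abs_of_nonpos (by linarith)]; linarith)
    rwa [abs_of_nonpos (by linarith), neg_neg] at h
  have bd2 : ∀ y ∈ Set.Ioi b, ‖f y‖ ≤ K * Real.exp (-y) := fun y hy => by
    have hy : b < y := hy
    have h := hK y (by rw [abs_of_nonneg (by linarith)]; linarith)
    rwa [abs_of_nonneg (by linarith)] at h
  have i1 : MeasureTheory.IntegrableOn f (Set.Iic (-b)) :=
    MeasureTheory.Integrable.mono' hbI hf.aestronglyMeasurable.restrict
      ((MeasureTheory.ae_restrict_iff' measurableSet_Iic).2 (Eventually.of_forall bd1))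
  have i2 : MeasureTheory.IntegrableOn f (Set.Ioi b) :=
    MeasureTheory.Integrable.mono' hbI' hf.aestronglyMeasurable.restrict
      ((MeasureTheory.ae_restrict_iff' measurableSet_Ioi).2 (Eventually.of_forall bd2))
  have i3 : MeasureTheory.IntegrableOn f (Set.Ioc (-b) b) :=
    hf.integrableOn_Icc.mono_set Set.Ioc_subset_Icc_self
  have i4 : MeasureTheory.IntegrableOn f (Set.Ioi (-b)) := by
    rw [← Set.Ioc_union_Ioi_eq_Ioi (by linarith : -b ≤ b)]
    exact i3.union i2
  have e1 := intervalIntegral.integral_Iic_add_Ioi i1 i4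
  have e2 : ∫ y in Set.Ioi (-b), f y = (∫ y in (-b)..b, f y) + ∫ y in Set.Ioi b, f y := by
    have hdis : Disjoint (Set.Ioc (-b) b) (Set.Ioi b) :=
      Set.disjoint_left.2 fun y h1 h2 => not_lt.2 h1.2 h2
    rw [intervalIntegral.integral_of_le (by linarith),
      ← MeasureTheory.setIntegral_union hdis measurableSet_Ioi i3 i2,
      Set.Ioc_union_Ioi_eq_Ioi (by linarith)]
  have e3 : (∫ y, f y) - ∫ y in (-b)..b, f y
      = (∫ y in Set.Iic (-b), f y) + ∫ y in Set.Ioi b, f y := by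
    rw [← e1, e2]; ring
  have n1 : ‖∫ y in Set.Iic (-b), f y‖ ≤ K * Real.exp (-b) := by
    have := MeasureTheory.norm_integral_le_of_norm_le hbI
      ((MeasureTheory.ae_restrict_iff' measurableSet_Iic).2 (Eventually.of_forall bd1))
    rwa [MeasureTheory.integral_const_mul, integral_exp_Iic] at this
  have n2 : ‖∫ y in Set.Ioi b, f y‖ ≤ K * Real.exp (-b) := by
    have := MeasureTheory.norm_integral_le_of_norm_le hbI'
      ((MeasureTheory.ae_restrict_iff' measurableSet_Ioi).2 (Eventually.of_forall bd2))
    rwa [MeasureTheory.integral_const_mul, integral_exp_neg_Ioi] at this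
  rw [e3]
  exact (norm_add_le _ _).trans (by linarith)

lemma one_le_div_two_pi {t : ℝ} (ht : 8 ≤ t) : 1 ≤ t / (2 * Real.pi) := by
  rw [one_le_div (by positivity)]
  linarith [Real.pi_lt_four]

lemma div_two_pi_le {t : ℝ} (ht : 0 ≤ t) : t / (2 * Real.pi) ≤ t :=
  div_le_self ht (by linarith [Real.pi_gt_three])

lemma norm_powIntegrand_side_le {t b : ℝ} (ht : 8 ≤ t) (hb : 1 ≤ b) (hbt : b ≤ t / 2) {x : ℂ}
    (hx : |x.re| = b) (h1 : -2 ≤ x.im) (h2 : x.im ≤ 0) :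
    ‖powIntegrand t x‖ ≤ 160 * t ^ 2 * Real.exp (-(3 / 2 * b)) := by
  have e1 := norm_ofReal_cpow_I_mul_le (one_le_div_two_pi ht) h1
  have e2 := norm_zeta_half_le (by linarith : 2 ≤ t) (hx.trans_le hbt) h1 h2
  have e3 := norm_kernel_le_exp (x := x) (hx ▸ hb)
  rw [hx] at e3
  rw [powIntegrand, norm_mul, norm_mul]
  calc _ ≤ t * (20 * t) * (8 * Real.exp (-(3 / 2 * b))) := by
        gcongr
        exact e1.trans (div_two_pi_le (by linarith))
    _ = _ := by ring

lemma norm_powIntegrand_shift_le {t b p q : ℝ} (ht : 8 ≤ t) (hb : 1 ≤ b) (hbt : b < t / 2)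
    (hp : 0 < p) (hpq : p ≤ q) (hq : q < 2) :
    ‖(∫ y in (-b)..b, powIntegrand t (y - p * I)) - ∫ y in (-b)..b, powIntegrand t (y - q * I)‖
      ≤ 640 * t ^ 2 * Real.exp (-(3 / 2 * b)) := by
  have h := norm_intervalIntegral_sub_le_of_differentiableAt (f := powIntegrand t) (b := b)
    (M := 160 * t ^ 2 * Real.exp (-(3 / 2 * b))) (by linarith) hpq
    (fun x hx h1 h2 => by
      have hx' := abs_le.1 hx
      exact ((differentiableAt_ofReal_cpow_I_mul (by
        have := one_le_div_two_pi ht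
        linarith) x).mul (differentiableAt_zeta_half (half_add_I_mul_ne_one (by linarith)))).mul
        (differentiableAt_kernel (by linarith) (by linarith)))
    (fun x hx h1 h2 => norm_powIntegrand_side_le ht hb hbt.le hx (by linarith) (by linarith))
  refine h.trans ?_
  have : 0 ≤ 160 * t ^ 2 * Real.exp (-(3 / 2 * b)) := by positivity
  nlinarith

lemma norm_exp_theta_sub_cpow_le {t y : ℝ} (ht : 8 ≤ t) (hy : |y| ≤ t / 2)
    (hy2 : |y| * (14 + |y|) ≤ t) :
    ‖cexp (I * theta (t + y) - I * theta t) - ((t / (2 * Real.pi) : ℝ) : ℂ) ^ (I * y / 2)‖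
      ≤ 2 * (|y| * (14 + |y|) / t) := by
  have ht0 : 0 < t := by linarith
  have hτ : 0 < t / (2 * Real.pi) := by positivity
  set L : ℝ := Real.log (t / (2 * Real.pi)) / 2 with hL
  have hΔ := norm_theta_add_sub_le (by linarith : 2 ≤ t) hy
  set Δ : ℂ := theta (t + y) - theta t - ((y * L : ℝ) : ℂ) with hΔd
  have e2 : ((t / (2 * Real.pi) : ℝ) : ℂ) ^ (I * y / 2) = cexp ((y * L : ℝ) * I) := by
    rw [cpow_def_of_ne_zero (by exact_mod_cast hτ.ne'), ← ofReal_log hτ.le]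
    congr 1
    rw [hL]; push_cast; ring
  have e1 : cexp (I * theta (t + y) - I * theta t) = cexp ((y * L : ℝ) * I) * cexp (I * Δ) := by
    rw [← Complex.exp_add]; congr 1; rw [hΔd]; ring
  have hn : ‖I * Δ‖ ≤ |y| * (14 + |y|) / t := by rwa [norm_mul, norm_I, one_mul]
  rw [e1, e2, ← mul_sub_one, norm_mul, norm_exp_ofReal_mul_I, one_mul]
  exact (norm_exp_sub_one_le (hn.trans ((div_le_one ht0).2 hy2))).trans (by gcongr)

lemma exists_norm_integral_sub_le {c : ℝ} (hc0 : 0 < c) (hc : c < 1 / 2) :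
    ∃ K : ℝ, 0 ≤ K ∧ ∀ t b Z : ℝ, 8 ≤ t → 1 ≤ b → b < t / 2 → b * (14 + b) ≤ t →
      (∀ y : ℝ, |y| ≤ b → ‖riemannZeta (1 / 2 + I * (t + y))‖ ≤ Z) →
      ‖(∫ y in (-b)..b, thetaIntegrand t (y - c * I)) - ∫ y in (-b)..b, powIntegrand t (y - c * I)‖
        ≤ 4 * (b * (14 + b)) / t * Z + K * t ^ 2 * Real.exp (-(3 / 2 * b)) := by
  obtain ⟨K, hK, hbd⟩ := exists_norm_exp_I_mul_theta_le hc0.le hc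
  refine ⟨480 * K + 160, by positivity, fun t b Z ht hb hbt hbt2 hZ => ?_⟩
  have ht0 : 0 < t := by linarith
  have hτ := one_le_div_two_pi ht
  have hZ0 : 0 ≤ Z := (norm_nonneg _).trans (hZ 0 (by simp; linarith))
  set D : ℂ → ℂ := fun x => cexp (I * theta (t + x) - I * theta t)
    - ((t / (2 * Real.pi) : ℝ) : ℂ) ^ (I * x / 2) with hD
  have hDd : ∀ x : ℂ, |x.im| < 1 / 2 → DifferentiableAt ℂ D x := fun x hx =>
    (differentiableAt_exp_theta hx).sub (differentiableAt_ofReal_cpow_I_mul (by linarith) x)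
  obtain ⟨F, hF, hFe⟩ := exists_differentiableAt_eq_mul_kernel (c := 1 / 2) (by norm_num)
    (by norm_num) hDd (by simp [hD])
  set G : ℂ → ℂ := fun x => F x * riemannZeta (1 / 2 + I * (t + x)) with hG
  have hGe : ∀ x : ℂ, x ≠ 0 → G x = thetaIntegrand t x - powIntegrand t x := fun x hx => by
    simp only [hG, hFe x hx, hD, thetaIntegrand, powIntegrand]; ring
  have hline : ∀ y : ℝ, ((y : ℂ) - c * I) ≠ 0 := fun y h => by
    have := congrArg Complex.im h
    simp at this
    linarith
  have hshift := norm_intervalIntegral_sub_le_of_differentiableAt (f := G) (b := b) (p := 0)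
    (q := c) (M := (480 * K + 160) * t ^ 2 * Real.exp (-(3 / 2 * b))) (by linarith) hc0.le
    (fun x hx h1 h2 => by
      have hx' := abs_le.1 hx
      exact (hF x (by linarith) (by linarith)).mul
        (differentiableAt_zeta_half (half_add_I_mul_ne_one (by linarith))))
    (fun x hx h1 h2 => by
      have hx0 : x ≠ 0 := fun h => by rw [h] at hx; simp at hx; linarith
      rw [hGe x hx0]
      refine (norm_sub_le _ _).trans ?_
      have e1 := norm_powIntegrand_side_le ht hb hbt.le hx (by linarith) (by linarith)
      have e2 := norm_zeta_half_le (by linarith : 2 ≤ t) (hx.trans_le hbt.le)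
        (by linarith) (by linarith)
      have e3 := norm_kernel_le_exp (x := x) (hx ▸ hb)
      rw [hx] at e3
      have e4 : ‖cexp (I * theta (t + x) - I * theta t)‖ ≤ K * (3 * t) := by
        rw [norm_exp_theta_sub]
        refine (hbd (t + x) ?_).trans ?_
        · simp only [add_im, ofReal_im, zero_add]
          exact abs_le.2 ⟨by linarith, by linarith⟩
        · gcongr
          have := abs_add_le t x.re
          rw [hx, abs_of_pos ht0] at this
          simp only [add_re, ofReal_re]
          linarith
      have e5 : ‖thetaIntegrand t x‖ ≤ 480 * K * t ^ 2 * Real.exp (-(3 / 2 * b)) := by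
        rw [thetaIntegrand, norm_mul, norm_mul]
        calc _ ≤ K * (3 * t) * (20 * t) * (8 * Real.exp (-(3 / 2 * b))) := by gcongr
          _ = _ := by ring
      linarith)
  have hpow_cont : Continuous fun y : ℝ => powIntegrand t (y - c * I) := by
    rw [continuous_iff_continuousAt]
    intro y
    have him : ((y : ℂ) - c * I).im = -c := by simp
    have hne : (1 / 2 + I * (t + ((y : ℂ) - c * I)) : ℂ) ≠ 1 := fun h => by
      have := half_add_I_mul_re t ((y : ℂ) - c * I)
      rw [h, him, one_re] at this
      linarith
    have h1 := ((differentiableAt_ofReal_cpow_I_mul (τ := t / (2 * Real.pi)) (by linarith)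
      ((y : ℂ) - c * I)).mul
      (differentiableAt_zeta_half hne)).mul (differentiableAt_kernel (x := (y : ℂ) - c * I)
        (by rw [him]; linarith) (by rw [him]; linarith))
    exact ContinuousAt.comp (f := fun y : ℝ => (y : ℂ) - c * I) h1.continuousAt (by fun_prop)
  have hGc : (∫ y in (-b)..b, G (y - c * I)) = (∫ y in (-b)..b, thetaIntegrand t (y - c * I))
      - ∫ y in (-b)..b, powIntegrand t (y - c * I) := by
    rw [← intervalIntegral.integral_sub
      ((continuous_thetaIntegrand_line hc0 hc t).intervalIntegrable _ _)
      (hpow_cont.intervalIntegrable _ _)]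
    exact intervalIntegral.integral_congr fun y _ => hGe _ (hline y)
  have hG0 : ‖∫ y in (-b)..b, G (y - (0 : ℝ) * I)‖ ≤ 4 * (b * (14 + b)) / t * Z := by
    have h := intervalIntegral.norm_integral_le_of_norm_le_const_ae (a := -b) (b := b)
      (f := fun y : ℝ => G (y - (0 : ℝ) * I)) (C := 2 * (14 + b) / t * Z) (by
        have hne : ∀ᵐ y : ℝ ∂MeasureTheory.volume, y ≠ 0 := by
          simp [MeasureTheory.ae_iff, MeasureTheory.measure_singleton]
        filter_upwards [hne] with y hy0 hy
        rw [Set.uIoc_of_le (by linarith)] at hy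
        have hyb : |y| ≤ b := abs_le.2 ⟨hy.1.le, hy.2⟩
        have hy0' : 0 < |y| := abs_pos.2 hy0
        have hyc : (y : ℂ) ≠ 0 := by exact_mod_cast hy0
        rw [ofReal_zero, zero_mul, sub_zero]
        simp only [hG, hFe _ hyc, hD]
        have e1 := norm_exp_theta_sub_cpow_le ht (hyb.trans hbt.le)
          (le_trans (by gcongr) hbt2)
        rw [norm_mul, norm_mul]
        calc _ ≤ 2 * (|y| * (14 + |y|) / t) * (1 / |y|) * Z := by
              gcongr
              · exact norm_kernel_ofReal_le hy0
              · exact hZ y hyb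
          _ = 2 * (14 + |y|) / t * Z := by field_simp
          _ ≤ _ := by gcongr)
    rw [abs_of_nonneg (by linarith)] at h
    refine h.trans_eq ?_
    ring
  rw [← hGc]
  have h0 : 0 ≤ (480 * K + 160) * t ^ 2 * Real.exp (-(3 / 2 * b)) := by positivity
  calc ‖∫ y in (-b)..b, G (y - c * I)‖
      = ‖(∫ y in (-b)..b, G (y - (0 : ℝ) * I)) - ((∫ y in (-b)..b, G (y - (0 : ℝ) * I))
        - ∫ y in (-b)..b, G (y - c * I))‖ := by rw [sub_sub_cancel]
    _ ≤ _ := (norm_sub_le _ _).trans (add_le_add hG0 (hshift.trans (by nlinarith)))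

/-- The approximation of `U`, with an error term governed by a bound for `ζ` on the critical
line. -/
lemma isBigO_U_sub_truncatedIntegral {α δ σ c C : ℝ} (hα : 0 ≤ α) (hδ : 0 < δ) (hδ1 : δ ≤ 1)
    (hσ₀ : 0 < σ) (hσ₂ : σ < 2) (hc0 : 0 < c) (hc : c < 1 / 2) (hC : 3 ≤ C)
    (hζ : (fun t : ℝ => riemannZeta (1 / 2 + I * t)) =O[atTop] fun t : ℝ => t ^ α) :
    (fun t : ℝ => U c t - truncatedIntegral σ (C * Real.log t) t)
      =O[atTop] fun t : ℝ => t ^ (α - 1 + δ) := by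
  obtain ⟨A, hA0, hA⟩ := hζ.exists_pos
  rw [IsBigOWith, eventually_atTop] at hA
  obtain ⟨T₀, hT₀⟩ := hA
  obtain ⟨K₁, hK₁, htail⟩ := exists_norm_thetaIntegrand_line_le hc0 hc
  obtain ⟨K₂, hK₂, hmid⟩ := exists_norm_integral_sub_le hc0 hc
  refine IsBigO.of_bound (2 * K₁ + K₂ + 640 + 4 * A * 2 ^ α) ?_
  have hlog : (fun t : ℝ => C * Real.log t) =o[atTop] fun t : ℝ => t ^ (δ / 2) :=
    (isLittleO_log_rpow_atTop (by positivity)).const_mul_left C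
  filter_upwards [eventually_ge_atTop 8, eventually_ge_atTop (2 * T₀),
    hlog.bound (by norm_num : (0 : ℝ) < 1 / 4)] with t ht htT hb4
  have ht0 : 0 < t := by linarith
  have hpi := Real.pi_gt_three
  set b := C * Real.log t with hb
  have hlog1 : 1 ≤ Real.log t := by
    rw [Real.le_log_iff_exp_le ht0]
    linarith [Real.exp_one_lt_d9]
  have hb1 : 1 ≤ b := by rw [hb]; nlinarith
  rw [Real.norm_of_nonneg (by linarith), Real.norm_of_nonneg (by positivity)] at hb4
  set v := t ^ (δ / 2) with hv
  have hv2 : v ^ 2 = t ^ δ := by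
    rw [hv, ← Real.rpow_natCast, ← Real.rpow_mul ht0.le]; congr 1; push_cast; ring
  have htδ : t ^ δ ≤ t := by
    calc t ^ δ ≤ t ^ (1 : ℝ) := Real.rpow_le_rpow_of_exponent_le (by linarith) hδ1
      _ = t := Real.rpow_one t
  have hbb : b * (14 + b) ≤ t ^ δ := by rw [← hv2]; nlinarith
  have hbt : b < t / 2 := by nlinarith
  have hexp : ∀ k : ℝ, 1 ≤ k → t ^ 2 * Real.exp (-(k * b)) ≤ t ^ (α - 1 + δ) := by
    intro k hk
    have h3 : Real.exp (-(k * b)) ≤ t ^ (-3 : ℝ) := by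
      rw [Real.rpow_def_of_pos ht0]
      gcongr
      rw [hb]; nlinarith [mul_le_mul hk hC (by norm_num) (by linarith : 0 ≤ k)]
    calc t ^ 2 * Real.exp (-(k * b)) ≤ t ^ (2 : ℝ) * t ^ (-3 : ℝ) := by
          rw [Real.rpow_two]; gcongr
      _ = t ^ (-1 : ℝ) := by rw [← Real.rpow_add ht0]; norm_num
      _ ≤ _ := Real.rpow_le_rpow_of_exponent_le (by linarith) (by linarith)
  have hU : U c t = 1 / (2 * Real.pi * I) * ∫ y : ℝ, thetaIntegrand t (y - c * I) := rfl
  have hTr : truncatedIntegral σ b t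
      = 1 / (2 * Real.pi * I) * ∫ y in (-b)..b, powIntegrand t (y - σ * I) := rfl
  have n1 := norm_integral_sub_intervalIntegral_le (continuous_thetaIntegrand_line hc0 hc t) hb1
    (htail t (by linarith))
  have n2 := hmid t b (A * (2 * t) ^ α) ht hb1 hbt (hbb.trans htδ) (fun y hy => by
    have hy' := abs_le.1 hy
    have h := hT₀ (t + y) (by linarith)
    rw [Real.norm_of_nonneg (Real.rpow_nonneg (by linarith) _)] at h
    push_cast at h
    refine h.trans ?_
    gcongr
    · linarith
    · linarith)
  have n3 : ‖(∫ y in (-b)..b, powIntegrand t (y - c * I))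
      - ∫ y in (-b)..b, powIntegrand t (y - σ * I)‖ ≤ 640 * t ^ 2 * Real.exp (-(3 / 2 * b)) := by
    rcases le_total c σ with h | h
    · exact norm_powIntegrand_shift_le ht hb1 hbt hc0 h hσ₂
    · rw [norm_sub_rev]
      exact norm_powIntegrand_shift_le ht hb1 hbt hσ₀ h (by linarith)
  have m1 : 2 * (K₁ * t ^ 2) * Real.exp (-b) ≤ 2 * K₁ * t ^ (α - 1 + δ) := by
    have := mul_le_mul_of_nonneg_left (hexp 1 le_rfl) hK₁
    rw [one_mul] at this
    linarith
  have m2 : K₂ * t ^ 2 * Real.exp (-(3 / 2 * b)) ≤ K₂ * t ^ (α - 1 + δ) := by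
    rw [mul_assoc]; exact mul_le_mul_of_nonneg_left (hexp _ (by norm_num)) hK₂
  have m3 : 640 * t ^ 2 * Real.exp (-(3 / 2 * b)) ≤ 640 * t ^ (α - 1 + δ) := by
    rw [mul_assoc]; exact mul_le_mul_of_nonneg_left (hexp _ (by norm_num)) (by norm_num)
  have m4 : 4 * (b * (14 + b)) / t * (A * (2 * t) ^ α) ≤ 4 * A * 2 ^ α * t ^ (α - 1 + δ) := by
    have e : t ^ (α - 1 + δ) = t ^ α * t ^ δ / t := by
      rw [show α - 1 + δ = α + δ - 1 by ring, Real.rpow_sub ht0, Real.rpow_add ht0, Real.rpow_one]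
    rw [e, Real.mul_rpow (by norm_num) ht0.le]
    calc _ ≤ 4 * t ^ δ / t * (A * (2 ^ α * t ^ α)) := by gcongr
      _ = _ := by ring
  have hpref : ‖(1 / (2 * Real.pi * I) : ℂ)‖ ≤ 1 := by
    rw [norm_div, norm_mul, norm_mul, norm_I, norm_real, Real.norm_of_nonneg Real.pi_pos.le,
      norm_one, Complex.norm_ofNat, mul_one]
    exact div_le_one_of_le₀ (by linarith) (by positivity)
  rw [hU, hTr, ← mul_sub, norm_mul, Real.norm_of_nonneg (by positivity)]
  refine (mul_le_of_le_one_left (norm_nonneg _) hpref).trans ?_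
  calc _ = ‖((∫ y : ℝ, thetaIntegrand t (y - c * I)) - ∫ y in (-b)..b, thetaIntegrand t (y - c * I))
        + ((∫ y in (-b)..b, thetaIntegrand t (y - c * I))
          - ∫ y in (-b)..b, powIntegrand t (y - c * I))
        + ((∫ y in (-b)..b, powIntegrand t (y - c * I))
          - ∫ y in (-b)..b, powIntegrand t (y - σ * I))‖ := by congr 1; ring
    _ ≤ _ := norm_add₃_le
    _ ≤ _ := by linarith

end ZetaApprox

theorem theoremT (ε σ : ℝ) (hε₀ : 0 < ε) (hε₁ : ε < 1) (hσ₀ : 0 < σ) (hσ₂ : σ < 2) :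
    ∃ C₀ : ℝ, 0 < C₀ ∧ ∀ C : ℝ, C₀ ≤ C → ∀ c : ℝ, 0 < c → c < 1 / 2 →
      ((fun t : ℝ => ZetaApprox.U c t - ZetaApprox.truncatedIntegral σ (C * Real.log t) t)
          =O[atTop] (fun t : ℝ => t ^ (-(5 / 6 : ℝ) + ε))) ∧
      (ZetaApprox.LindelofHypothesis →
        (fun t : ℝ => ZetaApprox.U c t - ZetaApprox.truncatedIntegral σ (C * Real.log t) t)
          =O[atTop] (fun t : ℝ => t ^ (-1 + ε))) := by
  refine ⟨3, by norm_num, fun C hC c hc0 hc => ⟨?_, fun hL => ?_⟩⟩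
  · have h := ZetaApprox.isBigO_U_sub_truncatedIntegral (α := 1 / 6 + ε / 2) (δ := ε / 2)
      (by positivity) (by positivity) (by linarith) hσ₀ hσ₂ hc0 hc hC
      (ZetaApprox.isBigO_riemannZeta_half (by positivity))
    rwa [show 1 / 6 + ε / 2 - 1 + ε / 2 = -(5 / 6 : ℝ) + ε by ring] at h
  · have h := ZetaApprox.isBigO_U_sub_truncatedIntegral (α := ε / 2) (δ := ε / 2)
      (by positivity) (by positivity) (by linarith) hσ₀ hσ₂ hc0 hc hC (hL _ (by positivity))
    rwa [show ε / 2 - 1 + ε / 2 = -1 + ε by ring] at h
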